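/- **Main Theorem.** Let $[a,b]\subset\mathbb{R}$ with $a<b$, let $m\ge 1$, $r\ge 2$ and $n\ge 0$ be integers, and let $0<\alpha\le 1$ and $\varepsilon_0>0$ be real numbers. For an integer $k\ge 0$, let $C^{k,\alpha}$ be the space of all $k$ times continuously differentiable functions $x:[a,b]\to\mathbb{C}$ such that the norm $$\|x\|_{k,\alpha}:=\sum_{j=0}^{k}\max_{a\le t\le b}|x^{(j)}(t)|+\sup_{a\le t_1<t_2\le b}\frac{|x^{(k)}(t_2)-x^{(k)}(t_1)|}{|t_2-t_1|^{\alpha}}$$ is finite. Let $(C^{k,\alpha})^m$ and $(C^{k,\alpha})^{m\times m}$ be the spaces of vector-valued and matrix-valued functions with entries in $C^{k,\alpha}$, normed by the sums of the norms of all the entries. For every $\varepsilon\in[0,\varepsilon_0)$ let there be given matrix-valued functions $A_0(\cdot,\varepsilon),\dots,A_{r-1}(\cdot,\varepsilon)\in(C^{n,\alpha})^{m\times m}$ and an arbitrary continuous linear operator $B(\varepsilon):(C^{n+r,\alpha})^m\to\mathbb{C}^{rm}$; no regularity in $\varepsilon$ is assumed. For $y\in (C^{n+r,\alpha})^m$ put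 $$L(\varepsilon)y:=y^{(r)}+\sum_{j=1}^{r}A_{r-j}(\cdot,\varepsilon)\,y^{(r-j)},$$ and, for $f(\cdot,\varepsilon)\in(C^{n,\alpha})^m$ and $c(\varepsilon)\in\mathbb{C}^{rm}$, consider the boundary-value problem $$L(\varepsilon)y(\cdot,\varepsilon)=f(\cdot,\varepsilon)\ \text{ on }[a,b],\qquad B(\varepsilon)y(\cdot,\varepsilon)=c(\varepsilon),\qquad y(\cdot,\varepsilon)\in(C^{n+r,\alpha})^m.\tag{1}$$ The solution to (1) is said to *depend continuously on the parameter $\varepsilon$ at $\varepsilon=0$* if the following two conditions are satisfied: * $(\ast)$ there is a positive number $\varepsilon_1<\varepsilon_0$ such that, for every $\varepsilon\in[0,\varepsilon_1)$ and all $f(\cdot,\varepsilon)\in(C^{n,\alpha})^m$ and $c(\varepsilon)\in\mathbb{C}^{rm}$, problem (1) has a unique solution $y(\cdot,\varepsilon)\in(C^{n+r,\alpha})^m$; * $(\ast\ast)$ whenever $f(\cdot,\varepsilon)\to f(\cdot,0)$ in $(C^{n,\alpha})^m$ and $c(\varepsilon)\to c(0)$ in $\mathbb{C}^{rm}$ as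 $\varepsilon\to0+$, these solutions satisfy $y(\cdot,\varepsilon)\to y(\cdot,0)$ in $(C^{n+r,\alpha})^m$ as $\varepsilon\to0+$. Then the solution to (1) depends continuously on the parameter $\varepsilon$ at $\varepsilon=0$ if and only if the following three conditions hold: * (0) the homogeneous problem $L(0)y=0$ on $[a,b]$, $B(0)y=0$ has only the trivial solution $y=0$ in $(C^{n+r,\alpha})^m$; * (I) $A_{r-j}(\cdot,\varepsilon)\to A_{r-j}(\cdot,0)$ in $(C^{n,\alpha})^{m\times m}$ as $\varepsilon\to0+$ for each $j\in\{1,\dots,r\}$; * (II) $B(\varepsilon)y\to B(0)y$ in $\mathbb{C}^{rm}$ as $\varepsilon\to0+$ for every $y\in(C^{n+r,\alpha})^m$. -/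

import Mathlib

open Set Filter Topology

/-- The `j`-th derivative of a function on `[a, b]` (one-sided at the end points). The constant
extension of the function past the end points is used only to feed Mathlib's `iteratedDerivWithin`,
which looks at the values on `[a, b]` alone. -/
noncomputable def iccDeriv {a b : ℝ} (h : a < b) (j : ℕ) (x : Icc a b → ℂ) : Icc a b → ℂ :=
  fun t => iteratedDerivWithin j (IccExtend h.le x) (Icc a b) t

/-- Hölder difference quotient of `u` at a pair `t₁ < t₂` of points of `[a, b]`. -/
noncomputable def holderQuot {a b : ℝ} (α : ℝ) (u : Icc a b → ℂ)
    (p : {p : Icc a b × Icc a b // p.1 < p.2}) : ℝ :=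
  ‖u p.1.2 - u p.1.1‖ / |(p.1.2 : ℝ) - (p.1.1 : ℝ)| ^ α

/-- Membership in `C^{n,α}([a,b], ℂ)`: `x` is `n` times continuously differentiable on `[a, b]`
and the Hölder quotients of `x^{(n)}` are bounded. -/
def MemHolderSpace {a b : ℝ} (h : a < b) (n : ℕ) (α : ℝ) (x : Icc a b → ℂ) : Prop :=
  ContDiffOn ℝ n (IccExtend h.le x) (Icc a b) ∧ BddAbove (range (holderQuot α (iccDeriv h n x)))

/-- `‖x‖_{n,α} = ∑_{j ≤ n} max |x^{(j)}| + sup_{t₁ < t₂} |x^{(n)}(t₂) - x^{(n)}(t₁)| / |t₂ - t₁|^α`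
on `[a, b]`. -/
noncomputable def holderNorm {a b : ℝ} (h : a < b) (n : ℕ) (α : ℝ) (x : Icc a b → ℂ) : ℝ :=
  (∑ j ∈ Finset.range (n + 1), ⨆ t : Icc a b, ‖iccDeriv h j x t‖) +
    ⨆ p, holderQuot α (iccDeriv h n x) p

section HolderLemmas

variable {a b : ℝ} (h : a < b) {n : ℕ} {α : ℝ} {x y : Icc a b → ℂ}

theorem iccDeriv_zero (x : Icc a b → ℂ) : iccDeriv h 0 x = x := by
  funext t
  simp [iccDeriv]

theorem iccDeriv_add {j : ℕ} (hx : ContDiffOn ℝ j (IccExtend h.le x) (Icc a b))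
    (hy : ContDiffOn ℝ j (IccExtend h.le y) (Icc a b)) :
    iccDeriv h j (x + y) = iccDeriv h j x + iccDeriv h j y := by
  funext t
  simp only [iccDeriv, Pi.add_apply]
  exact iteratedDerivWithin_add t.2 (uniqueDiffOn_Icc h) (hx t t.2) (hy t t.2)

theorem iccDeriv_smul {j : ℕ} (c : ℂ) (hx : ContDiffOn ℝ j (IccExtend h.le x) (Icc a b)) :
    iccDeriv h j (c • x) = c • iccDeriv h j x := by
  funext t
  simp only [iccDeriv, Pi.smul_apply]
  exact iteratedDerivWithin_const_smul t.2 (uniqueDiffOn_Icc h) c (hx t t.2)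

theorem holderQuot_nonneg (α : ℝ) (u : Icc a b → ℂ) (p) : 0 ≤ holderQuot α u p := by
  unfold holderQuot; positivity

theorem holderQuot_add_le (α : ℝ) (u v : Icc a b → ℂ) (p) :
    holderQuot α (u + v) p ≤ holderQuot α u p + holderQuot α v p := by
  unfold holderQuot
  rw [← add_div]
  gcongr
  simp only [Pi.add_apply]
  rw [add_sub_add_comm]
  exact norm_add_le _ _

theorem holderQuot_smul (α : ℝ) (c : ℂ) (u : Icc a b → ℂ) (p) :
    holderQuot α (c • u) p = ‖c‖ * holderQuot α u p := by
  simp only [holderQuot, Pi.smul_apply, ← smul_sub, norm_smul, mul_div_assoc]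

theorem MemHolderSpace.bddAbove {h : a < b} (hx : MemHolderSpace h n α x) {j : ℕ} (hj : j ≤ n) :
    BddAbove (range fun t : Icc a b => ‖iccDeriv h j x t‖) := by
  have hc : ContinuousOn (iteratedDerivWithin j (IccExtend h.le x) (Icc a b)) (Icc a b) :=
    hx.1.continuousOn_iteratedDerivWithin (by exact_mod_cast hj) (uniqueDiffOn_Icc h)
  obtain ⟨C, hC⟩ := isCompact_Icc.exists_bound_of_continuousOn hc
  exact ⟨C, by rintro _ ⟨t, rfl⟩; exact hC t t.2⟩

theorem MemHolderSpace.contDiffOn {h : a < b} (hx : MemHolderSpace h n α x) {j : ℕ}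
    (hj : j ≤ n) : ContDiffOn ℝ j (IccExtend h.le x) (Icc a b) :=
  hx.1.of_le (by exact_mod_cast hj)

theorem MemHolderSpace.add {h : a < b} (hx : MemHolderSpace h n α x)
    (hy : MemHolderSpace h n α y) : MemHolderSpace h n α (x + y) := by
  refine ⟨hx.1.add hy.1, ?_⟩
  obtain ⟨C, hC⟩ := hx.2
  obtain ⟨D, hD⟩ := hy.2
  rw [iccDeriv_add h hx.1 hy.1]
  refine ⟨C + D, ?_⟩
  rintro _ ⟨p, rfl⟩
  exact (holderQuot_add_le α _ _ p).trans (add_le_add (hC ⟨p, rfl⟩) (hD ⟨p, rfl⟩))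

theorem MemHolderSpace.smul {h : a < b} (c : ℂ) (hx : MemHolderSpace h n α x) :
    MemHolderSpace h n α (c • x) := by
  refine ⟨hx.1.const_smul c, ?_⟩
  obtain ⟨C, hC⟩ := hx.2
  rw [iccDeriv_smul h c hx.1]
  refine ⟨‖c‖ * C, ?_⟩
  rintro _ ⟨p, rfl⟩
  rw [holderQuot_smul]
  exact mul_le_mul_of_nonneg_left (hC ⟨p, rfl⟩) (norm_nonneg c)

theorem memHolderSpace_zero : MemHolderSpace h n α (0 : Icc a b → ℂ) := by
  have h0 : ContDiffOn ℝ n (IccExtend h.le (0 : Icc a b → ℂ)) (Icc a b) := contDiffOn_const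
  refine ⟨h0, 0, ?_⟩
  rintro _ ⟨p, rfl⟩
  have := iccDeriv_smul h (0 : ℂ) h0
  rw [zero_smul, zero_smul] at this
  simp [this, holderQuot]

theorem holderNorm_nonneg : 0 ≤ holderNorm h n α x :=
  add_nonneg (Finset.sum_nonneg fun _ _ => Real.iSup_nonneg fun _ => norm_nonneg _)
    (Real.iSup_nonneg fun p => holderQuot_nonneg α _ p)

theorem MemHolderSpace.norm_add_le {h : a < b} (hx : MemHolderSpace h n α x)
    (hy : MemHolderSpace h n α y) :
    holderNorm h n α (x + y) ≤ holderNorm h n α x + holderNorm h n α y := by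
  unfold holderNorm
  rw [add_add_add_comm, ← Finset.sum_add_distrib]
  refine add_le_add (Finset.sum_le_sum fun j hj => ?_) ?_
  · have hj' : j ≤ n := Nat.lt_succ_iff.mp (Finset.mem_range.mp hj)
    rw [iccDeriv_add h (hx.contDiffOn hj') (hy.contDiffOn hj')]
    have : Nonempty (Icc a b) := ⟨⟨a, left_mem_Icc.2 h.le⟩⟩
    exact ciSup_le fun t => (_root_.norm_add_le _ _).trans
      (add_le_add (le_ciSup (hx.bddAbove hj') t) (le_ciSup (hy.bddAbove hj') t))
  · rw [iccDeriv_add h hx.1 hy.1]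
    exact Real.iSup_le (fun p => (holderQuot_add_le α _ _ p).trans
      (add_le_add (le_ciSup hx.2 p) (le_ciSup hy.2 p)))
      (add_nonneg (Real.iSup_nonneg fun p => holderQuot_nonneg α _ p)
        (Real.iSup_nonneg fun p => holderQuot_nonneg α _ p))

theorem MemHolderSpace.norm_smul {h : a < b} (c : ℂ) (hx : MemHolderSpace h n α x) :
    holderNorm h n α (c • x) = ‖c‖ * holderNorm h n α x := by
  unfold holderNorm
  rw [mul_add, Finset.mul_sum, iccDeriv_smul h c hx.1, Real.mul_iSup_of_nonneg (norm_nonneg c)]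
  congr 1
  · refine Finset.sum_congr rfl fun j hj => ?_
    have hj' : j ≤ n := Nat.lt_succ_iff.mp (Finset.mem_range.mp hj)
    rw [iccDeriv_smul h c (hx.contDiffOn hj'), Real.mul_iSup_of_nonneg (norm_nonneg c)]
    simp only [Pi.smul_apply, _root_.norm_smul]
  · simp only [holderQuot_smul]

theorem MemHolderSpace.norm_apply_le {h : a < b} (hx : MemHolderSpace h n α x) (t : Icc a b) :
    ‖x t‖ ≤ holderNorm h n α x := by
  have h1 : ‖x t‖ ≤ ⨆ t : Icc a b, ‖iccDeriv h 0 x t‖ := by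
    have := le_ciSup (hx.bddAbove (Nat.zero_le n)) t
    simpa only [iccDeriv_zero] using this
  have h2 : (⨆ t : Icc a b, ‖iccDeriv h 0 x t‖) ≤
      ∑ j ∈ Finset.range (n + 1), ⨆ t : Icc a b, ‖iccDeriv h j x t‖ :=
    Finset.single_le_sum (f := fun j => ⨆ t : Icc a b, ‖iccDeriv h j x t‖)
      (fun _ _ => Real.iSup_nonneg fun _ => norm_nonneg _) (Finset.mem_range.2 n.succ_pos)
  exact (h1.trans h2).trans
    (le_add_of_nonneg_right (Real.iSup_nonneg fun p => holderQuot_nonneg α _ p))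

end HolderLemmas

/-- The functions in `C^{n,α}([a,b], ℂ)` as a complex vector space. -/
def holderSubmodule {a b : ℝ} (h : a < b) (n : ℕ) (α : ℝ) : Submodule ℂ (Icc a b → ℂ) where
  carrier := {x | MemHolderSpace h n α x}
  add_mem' := fun hx hy => hx.add hy
  zero_mem' := memHolderSpace_zero h
  smul_mem' := fun c _ hx => hx.smul c

/-- The Hölder space `C^{n,α}([a,b], ℂ)`. It is a type synonym of `holderSubmodule`, so that its
topology is the one of the norm `‖·‖_{n,α}` and not that of pointwise convergence. -/
def HolderSpace {a b : ℝ} (h : a < b) (n : ℕ) (α : ℝ) : Type := holderSubmodule h n α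

namespace HolderSpace

variable {a b : ℝ} {h : a < b} {n : ℕ} {α : ℝ}

noncomputable instance : AddCommGroup (HolderSpace h n α) :=
  inferInstanceAs (AddCommGroup (holderSubmodule h n α))

noncomputable instance : Module ℂ (HolderSpace h n α) :=
  inferInstanceAs (Module ℂ (holderSubmodule h n α))

/-- The underlying function on `[a, b]`. -/
def toFun (x : HolderSpace h n α) : Icc a b → ℂ := Subtype.val x

instance : CoeFun (HolderSpace h n α) (fun _ => Icc a b → ℂ) := ⟨toFun⟩

noncomputable instance : Norm (HolderSpace h n α) := ⟨fun x => holderNorm h n α x⟩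

theorem mem (x : HolderSpace h n α) : MemHolderSpace h n α x := Subtype.property x

theorem normCore : NormedSpace.Core ℂ (HolderSpace h n α) where
  norm_nonneg := fun _ => holderNorm_nonneg h
  norm_smul := fun c x => (mem x).norm_smul c
  norm_triangle := fun x y => (mem x).norm_add_le (mem y)
  norm_eq_zero_iff := fun x => by
    constructor
    · intro hx
      refine Subtype.ext (funext fun t => ?_)
      have h1 : ‖x t‖ ≤ ‖x‖ := (mem x).norm_apply_le t
      rw [hx] at h1
      exact norm_le_zero_iff.1 h1
    · rintro rfl
      have h1 := (mem (0 : HolderSpace h n α)).norm_smul 0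
      rw [norm_zero, zero_mul] at h1
      rw [← h1]
      exact congrArg (holderNorm h n α) (zero_smul ℂ _).symm

noncomputable instance : NormedAddCommGroup (HolderSpace h n α) :=
  NormedAddCommGroup.ofCore normCore

noncomputable instance : NormedSpace ℂ (HolderSpace h n α) :=
  NormedSpace.ofCore normCore

end HolderSpace

/- Vector functions `(C^{n,α})^m` are `Fin m → HolderSpace h n α`, matrix functions
`(C^{n,α})^{m×m}` are `Matrix (Fin m) (Fin m) (HolderSpace h n α)`. Both carry the topology of
entrywise norm convergence, which is the topology of the norm given by the sum of the norms of all
entries. -/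

/-- `y` solves `y^{(r)}(t) + ∑_{l < r} A_l(t) y^{(l)}(t) = f(t)` for all `t ∈ [a, b]`, and
`B y = c`. Here `A l` is the coefficient of `y^{(l)}`. -/
def IsBVPSolution {a b : ℝ} {h : a < b} {m r n : ℕ} {α : ℝ}
    (A : Fin r → Matrix (Fin m) (Fin m) (HolderSpace h n α))
    (B : (Fin m → HolderSpace h (n + r) α) →L[ℂ] EuclideanSpace ℂ (Fin (r * m)))
    (f : Fin m → HolderSpace h n α) (c : EuclideanSpace ℂ (Fin (r * m)))
    (y : Fin m → HolderSpace h (n + r) α) : Prop :=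
  (∀ (t : Icc a b) (i : Fin m),
    iccDeriv h r (y i) t + ∑ l : Fin r, ∑ k : Fin m, A l i k t * iccDeriv h l (y k) t = f i t) ∧
  B y = c

/-- Continuous dependence of the solution on the parameter `ε ∈ [0, ε₀)` at `ε = 0`. Families are
indexed by all of `ℝ` for convenience; only their values at `ε ∈ [0, ε₀)` matter. -/
def DependsContinuouslyAtZero {a b : ℝ} {h : a < b} {m r n : ℕ} {α : ℝ} (ε₀ : ℝ)
    (A : ℝ → Fin r → Matrix (Fin m) (Fin m) (HolderSpace h n α))
    (B : ℝ → (Fin m → HolderSpace h (n + r) α) →L[ℂ] EuclideanSpace ℂ (Fin (r * m))) : Prop :=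
  ∃ ε₁ : ℝ, 0 < ε₁ ∧ ε₁ < ε₀ ∧
    (∀ ε ∈ Ico 0 ε₁, ∀ (f : Fin m → HolderSpace h n α) (c : EuclideanSpace ℂ (Fin (r * m))),
      ∃! y, IsBVPSolution (A ε) (B ε) f c y) ∧
    ∀ (f : ℝ → Fin m → HolderSpace h n α) (c : ℝ → EuclideanSpace ℂ (Fin (r * m)))
      (y : ℝ → Fin m → HolderSpace h (n + r) α),
      (∀ ε ∈ Ico 0 ε₁, IsBVPSolution (A ε) (B ε) (f ε) (c ε) (y ε)) →
      Tendsto f (𝓝[>] 0) (𝓝 (f 0)) → Tendsto c (𝓝[>] 0) (𝓝 (c 0)) →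
      Tendsto y (𝓝[>] 0) (𝓝 (y 0))

/-! Write `L(ε)` for the differential operator. Two facts carry the theorem: for each fixed `ε` the
pair `(L(ε), B(ε))` is bijective as soon as it is injective, and every limit in `ε` follows from an
absorption argument.

Bijectivity. If `y` has zero Cauchy data at `a`, then `y = J^r u` with `J` the integration from `a`
and `u = y^{(r)}`, and `L y = f` becomes a Volterra equation `(1 + V) u = f`. It is uniquely
solvable in continuous functions (`isUnit_one_add_volterraCLM`), and the solution inherits the
smoothness of the coefficients and of `f`. Hence `L` together with the Cauchy data is an isomorphism
(`cauchyEquiv`), the kernel of `L` has dimension `rm`, and linear algebra turns uniqueness for the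
boundary-value problem into solvability (`exists_bvp_solution_of_injective`).

Sufficiency. Convergence of the coefficients gives `L(ε) → L(0)` in operator norm. By
Banach–Steinhaus the `B(ε)` are eventually bounded, and on a finite-dimensional space their strong
convergence is norm convergence. So the estimate `‖y‖ ≤ C (‖L(ε) y‖ + ‖B(ε) y‖)` holds with one `C`
for all small `ε > 0` (`exists_eventually_norm_le_add`). It yields uniqueness, hence solvability,
and, applied to `y(ε) - y(0)`, convergence.

Necessity. Let `R(ε)` be the solution operator; `(∗∗)` says that `R(ε) p(ε) → R(0) p(0)` whenever
`p(ε) → p(0)`. The coefficients are recovered from the values of `L(ε)` on monomials, so `‖L(ε) -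
L(0)‖` is controlled by finitely many such values. Comparing a monomial with `R(ε)` of its data at
`0` bounds the distance of the coefficients by `o(1)` times itself plus `o(1)`
(`tendsto_zero_of_continuous_inverse`). A similar absorption in the finite-dimensional target gives
the convergence of `B(ε) y` (`tendsto_apply_of_continuous_inverse`). -/

/-! ### Calculus of Hölder functions: embeddings, products, primitives. -/

section HolderCalculus

variable {a b : ℝ} (h : a < b) {n : ℕ} {α : ℝ} {x y x' y' : Icc a b → ℂ}

theorem iccDeriv_one_apply (x : Icc a b → ℂ) (t : Icc a b) :
    iccDeriv h 1 x t = derivWithin (IccExtend h.le x) (Icc a b) t := by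
  simp [iccDeriv, iteratedDerivWithin_one]

theorem eqOn_IccExtend_iccDeriv_one (x : Icc a b → ℂ) :
    EqOn (IccExtend h.le (iccDeriv h 1 x)) (derivWithin (IccExtend h.le x) (Icc a b))
      (Icc a b) := by
  intro t ht
  rw [IccExtend_of_mem h.le _ ht, iccDeriv_one_apply]

theorem iccDeriv_succ (j : ℕ) (x : Icc a b → ℂ) :
    iccDeriv h (j + 1) x = iccDeriv h j (iccDeriv h 1 x) := by
  funext t
  rw [iccDeriv, iccDeriv, iteratedDerivWithin_succ']
  exact (iteratedDerivWithin_congr (eqOn_IccExtend_iccDeriv_one h x) t.2).symm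

theorem iccDeriv_add_index (i j : ℕ) (x : Icc a b → ℂ) :
    iccDeriv h (i + j) x = iccDeriv h i (iccDeriv h j x) := by
  induction j generalizing x with
  | zero => rw [iccDeriv_zero, add_zero]
  | succ j ih => rw [← add_assoc, iccDeriv_succ, ih, ← iccDeriv_succ]

theorem contDiffOn_succ_iff_iccDeriv :
    ContDiffOn ℝ (n + 1 : ℕ) (IccExtend h.le x) (Icc a b) ↔
      DifferentiableOn ℝ (IccExtend h.le x) (Icc a b) ∧
        ContDiffOn ℝ n (IccExtend h.le (iccDeriv h 1 x)) (Icc a b) := by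
  push_cast
  rw [contDiffOn_succ_iff_derivWithin (uniqueDiffOn_Icc h),
    contDiffOn_congr (eqOn_IccExtend_iccDeriv_one h x)]
  simp

theorem memHolderSpace_succ_iff :
    MemHolderSpace h (n + 1) α x ↔
      DifferentiableOn ℝ (IccExtend h.le x) (Icc a b) ∧
        MemHolderSpace h n α (iccDeriv h 1 x) := by
  rw [MemHolderSpace, MemHolderSpace, contDiffOn_succ_iff_iccDeriv,
    iccDeriv_succ h n x, and_assoc]

theorem holderNorm_zero_eq (x : Icc a b → ℂ) :
    holderNorm h 0 α x = (⨆ t, ‖x t‖) + ⨆ p, holderQuot α x p := by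
  simp [holderNorm, iccDeriv_zero]

/-- Together with `memHolderSpace_succ_iff` this drives the inductions on the order: a statement at
order `n + 1` becomes one about `x` in the sup norm and one about `x'` at order `n`. -/
theorem holderNorm_succ (x : Icc a b → ℂ) :
    holderNorm h (n + 1) α x = (⨆ t, ‖x t‖) + holderNorm h n α (iccDeriv h 1 x) := by
  have H := fun j => iccDeriv_succ h j x
  generalize iccDeriv h 1 x = z at H ⊢
  simp only [holderNorm, Finset.sum_range_succ' _ (n + 1), H, iccDeriv_zero]
  ring

theorem hasDerivWithinAt_iccDeriv (hx : DifferentiableOn ℝ (IccExtend h.le x) (Icc a b))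
    (t : Icc a b) : HasDerivWithinAt (IccExtend h.le x) (iccDeriv h 1 x t) (Icc a b) t := by
  rw [iccDeriv_one_apply]
  exact (hx t t.2).hasDerivWithinAt

theorem iccDeriv_one_eq
    (hx : ∀ t : Icc a b, HasDerivWithinAt (IccExtend h.le x) (x' t) (Icc a b) t) :
    iccDeriv h 1 x = x' := by
  funext t
  rw [iccDeriv_one_apply]
  exact (hx t).derivWithin (uniqueDiffOn_Icc h t t.2)

theorem differentiableOn_of_hasDerivWithinAt
    (hx : ∀ t : Icc a b, HasDerivWithinAt (IccExtend h.le x) (x' t) (Icc a b) t) :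
    DifferentiableOn ℝ (IccExtend h.le x) (Icc a b) :=
  fun t ht => (hx ⟨t, ht⟩).differentiableWithinAt

theorem continuous_of_contDiffOn (hx : ContDiffOn ℝ n (IccExtend h.le x) (Icc a b)) :
    Continuous x := by
  have := hx.continuousOn.comp_continuous continuous_subtype_val fun t => t.2
  simpa [Function.comp_def] using this

theorem MemHolderSpace.continuous {h : a < b} (hx : MemHolderSpace h n α x) : Continuous x :=
  continuous_of_contDiffOn h hx.1

/-- `α`-Hölder quotients of a `C`-Lipschitz function. -/
theorem holderQuot_le_of_lipschitz (hα : α ≤ 1) {C : ℝ} (hC : 0 ≤ C)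
    (hx : ∀ s t : Icc a b, ‖x t - x s‖ ≤ C * |(t : ℝ) - s|) (p) :
    holderQuot α x p ≤ C * (b - a) ^ (1 - α) := by
  obtain ⟨⟨s, t⟩, hst⟩ := p
  have hst' : (0 : ℝ) < t - s := sub_pos.2 hst
  have h1 : |(t : ℝ) - s| = t - s := abs_of_pos hst'
  unfold holderQuot
  simp only
  rw [h1, div_le_iff₀ (Real.rpow_pos_of_pos hst' _)]
  calc ‖x t - x s‖ ≤ C * (t - s) := h1 ▸ hx s t
    _ = C * ((t - s) ^ (1 - α) * (t - s) ^ α) := by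
        rw [← Real.rpow_add hst']; simp
    _ ≤ C * ((b - a) ^ (1 - α) * (t - s) ^ α) := by
        have h2 : (t : ℝ) - s ≤ b - a := by linarith [t.2.2, s.2.1]
        have h3 : (t - s : ℝ) ^ (1 - α) ≤ (b - a) ^ (1 - α) :=
          Real.rpow_le_rpow hst'.le h2 (sub_nonneg.2 hα)
        gcongr
    _ = _ := by ring

theorem lipschitz_of_hasDerivWithinAt
    (hx : ∀ t : Icc a b, HasDerivWithinAt (IccExtend h.le x) (x' t) (Icc a b) t) {C : ℝ}
    (hC : ∀ t, ‖x' t‖ ≤ C) (s t : Icc a b) : ‖x t - x s‖ ≤ C * |(t : ℝ) - s| := by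
  have := (convex_Icc a b).norm_image_sub_le_of_norm_hasDerivWithin_le
    (f := IccExtend h.le x) (f' := IccExtend h.le x') (C := C) (fun u hu => by
      rw [IccExtend_of_mem h.le _ hu]; exact hx ⟨u, hu⟩)
    (fun u hu => by rw [IccExtend_of_mem h.le _ hu]; exact hC ⟨u, hu⟩) s.2 t.2
  simpa using this

theorem memHolderSpace_zero_of_lipschitz (hα : α ≤ 1) {C : ℝ} (hC : 0 ≤ C)
    (hx : ∀ s t : Icc a b, ‖x t - x s‖ ≤ C * |(t : ℝ) - s|) : MemHolderSpace h 0 α x := by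
  constructor
  · have hc : Continuous x := by
      refine (LipschitzWith.of_dist_le_mul (K := ⟨C, hC⟩) fun s t => ?_).continuous
      rw [dist_eq_norm]
      exact hx t s
    simpa using (hc.Icc_extend' (h := h.le)).continuousOn
  · rw [iccDeriv_zero]
    exact ⟨_, by rintro _ ⟨p, rfl⟩; exact holderQuot_le_of_lipschitz hα hC hx p⟩

theorem MemHolderSpace.of_succ {h : a < b} (hα : α ≤ 1) (hx : MemHolderSpace h (n + 1) α x) :
    MemHolderSpace h n α x := by
  induction n generalizing x with
  | zero =>
    obtain ⟨hd, hx'⟩ := (memHolderSpace_succ_iff h).1 hx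
    exact memHolderSpace_zero_of_lipschitz h hα (holderNorm_nonneg h)
      (lipschitz_of_hasDerivWithinAt h (hasDerivWithinAt_iccDeriv h hd) hx'.norm_apply_le)
  | succ n ih =>
    obtain ⟨hd, hx'⟩ := (memHolderSpace_succ_iff h).1 hx
    exact (memHolderSpace_succ_iff h).2 ⟨hd, ih hx'⟩

/-- Only order `0` needs an argument: a bound on `x'` makes `x` Lipschitz, and for `α ≤ 1` a
Lipschitz function on a bounded interval is `α`-Hölder at the price of the factor `(b - a)^(1 - α)`.
-/
theorem MemHolderSpace.norm_le_succ {h : a < b} (hα : α ≤ 1)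
    (hx : MemHolderSpace h (n + 1) α x) :
    holderNorm h n α x ≤ (1 + (b - a) ^ (1 - α)) * holderNorm h (n + 1) α x := by
  have hb : (0 : ℝ) ≤ (b - a) ^ (1 - α) := Real.rpow_nonneg (sub_nonneg.2 h.le) _
  have hs : (0 : ℝ) ≤ ⨆ t, ‖x t‖ := Real.iSup_nonneg fun _ => norm_nonneg _
  induction n generalizing x with
  | zero =>
    obtain ⟨hd, hx'⟩ := (memHolderSpace_succ_iff h).1 hx
    rw [holderNorm_succ, holderNorm_zero_eq]
    have hN := holderNorm_nonneg h (n := 0) (α := α) (x := iccDeriv h 1 x)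
    have : (⨆ p, holderQuot α x p) ≤ holderNorm h 0 α (iccDeriv h 1 x) * (b - a) ^ (1 - α) :=
      Real.iSup_le (holderQuot_le_of_lipschitz hα (holderNorm_nonneg h)
        (lipschitz_of_hasDerivWithinAt h (hasDerivWithinAt_iccDeriv h hd) hx'.norm_apply_le))
        (mul_nonneg hN hb)
    nlinarith [mul_nonneg hb hs]
  | succ n ih =>
    obtain ⟨hd, hx'⟩ := (memHolderSpace_succ_iff h).1 hx
    rw [holderNorm_succ, holderNorm_succ h (n := n + 1)]
    have := ih hx' (Real.iSup_nonneg fun _ => norm_nonneg _)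
    nlinarith [mul_nonneg hb hs]

theorem MemHolderSpace.of_le {h : a < b} (hα : α ≤ 1) {k N : ℕ} (hk : k ≤ N)
    (hx : MemHolderSpace h N α x) : MemHolderSpace h k α x := by
  induction N, hk using Nat.le_induction with
  | base => exact hx
  | succ N _ ih => exact ih (hx.of_succ hα)

theorem exists_holderNorm_le_of_le (hα : α ≤ 1) {k N : ℕ} (hk : k ≤ N) :
    ∃ C : ℝ, 0 ≤ C ∧ ∀ x, MemHolderSpace h N α x → holderNorm h k α x ≤ C * holderNorm h N α x := by
  induction N, hk using Nat.le_induction with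
  | base => exact ⟨1, zero_le_one, fun x _ => by simp⟩
  | succ N _ ih =>
    obtain ⟨C, hC, H⟩ := ih
    have hb : (0 : ℝ) ≤ (b - a) ^ (1 - α) := Real.rpow_nonneg (sub_nonneg.2 h.le) _
    refine ⟨C * (1 + (b - a) ^ (1 - α)), by positivity, fun x hx => ?_⟩
    calc _ ≤ C * holderNorm h N α x := H x (hx.of_succ hα)
      _ ≤ C * _ := mul_le_mul_of_nonneg_left (hx.norm_le_succ hα) hC
      _ = _ := by ring

theorem MemHolderSpace.iccDeriv_mem {h : a < b} {j k : ℕ}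
    (hx : MemHolderSpace h (k + j) α x) : MemHolderSpace h k α (iccDeriv h j x) := by
  induction j generalizing x with
  | zero => rwa [iccDeriv_zero]
  | succ j ih =>
    rw [iccDeriv_succ]
    exact ih ((memHolderSpace_succ_iff h).1 hx).2

theorem holderNorm_iccDeriv_le (j k : ℕ) (x : Icc a b → ℂ) :
    holderNorm h k α (iccDeriv h j x) ≤ holderNorm h (k + j) α x := by
  induction j generalizing x with
  | zero => rw [iccDeriv_zero, add_zero]
  | succ j ih =>
    rw [iccDeriv_succ]
    refine (ih _).trans ?_
    rw [← add_assoc, holderNorm_succ]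
    exact le_add_of_nonneg_left (Real.iSup_nonneg fun _ => norm_nonneg _)

theorem iccDeriv_one_mul (hx : DifferentiableOn ℝ (IccExtend h.le x) (Icc a b))
    (hy : DifferentiableOn ℝ (IccExtend h.le y) (Icc a b)) :
    DifferentiableOn ℝ (IccExtend h.le (x * y)) (Icc a b) ∧
      iccDeriv h 1 (x * y) = iccDeriv h 1 x * y + x * iccDeriv h 1 y := by
  have key : ∀ t : Icc a b, HasDerivWithinAt (IccExtend h.le (x * y))
      ((iccDeriv h 1 x * y + x * iccDeriv h 1 y) t) (Icc a b) t := by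
    intro t
    have := (hasDerivWithinAt_iccDeriv h hx t).mul (hasDerivWithinAt_iccDeriv h hy t)
    simp only [IccExtend_val] at this
    exact this
  exact ⟨differentiableOn_of_hasDerivWithinAt h key, iccDeriv_one_eq h key⟩

theorem MemHolderSpace.holderQuot_le {h : a < b} (hx : MemHolderSpace h 0 α x) (p) :
    holderQuot α x p ≤ holderNorm h 0 α x := by
  rw [holderNorm_zero_eq]
  refine le_add_of_nonneg_of_le (Real.iSup_nonneg fun _ => norm_nonneg _) ?_
  have := hx.2
  rw [iccDeriv_zero] at this
  exact le_ciSup this p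

theorem holderQuot_mul_le (p) :
    holderQuot α (x * y) p ≤ ‖x p.1.2‖ * holderQuot α y p + holderQuot α x p * ‖y p.1.1‖ := by
  unfold holderQuot
  rw [mul_div_assoc', div_mul_eq_mul_div, ← add_div]
  gcongr
  rw [← norm_mul, ← norm_mul]
  refine le_trans (le_of_eq ?_) (norm_add_le _ _)
  congr 1
  simp only [Pi.mul_apply]
  ring

/-- Induction by Leibniz' rule `(xy)' = x'y + xy'`: in each term the undifferentiated factor is
brought down to order `n` by the embedding, which costs the factor `D`. -/
theorem exists_holderNorm_mul_le (hα : α ≤ 1) (n : ℕ) :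
    ∃ C : ℝ, 0 ≤ C ∧ ∀ x y, MemHolderSpace h n α x → MemHolderSpace h n α y →
      MemHolderSpace h n α (x * y) ∧
        holderNorm h n α (x * y) ≤ C * holderNorm h n α x * holderNorm h n α y := by
  have hsup : ∀ k x y, MemHolderSpace h k α x → MemHolderSpace h k α y →
      (⨆ t, ‖(x * y) t‖) ≤ holderNorm h k α x * holderNorm h k α y := fun k x y hx hy =>
    Real.iSup_le (fun t => by
      rw [Pi.mul_apply, norm_mul]
      exact mul_le_mul (hx.norm_apply_le t) (hy.norm_apply_le t) (norm_nonneg _)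
        (holderNorm_nonneg h)) (mul_nonneg (holderNorm_nonneg h) (holderNorm_nonneg h))
  induction n with
  | zero =>
    refine ⟨3, by norm_num, fun x y hx hy => ?_⟩
    have hq : ∀ p, holderQuot α (x * y) p ≤ 2 * (holderNorm h 0 α x * holderNorm h 0 α y) := by
      intro p
      refine (holderQuot_mul_le p).trans ?_
      rw [two_mul]
      refine add_le_add (mul_le_mul (hx.norm_apply_le _) (hy.holderQuot_le p)
        (holderQuot_nonneg _ _ _) (holderNorm_nonneg h)) (mul_le_mul (hx.holderQuot_le p)
        (hy.norm_apply_le _) (norm_nonneg _) (holderNorm_nonneg h))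
    refine ⟨⟨?_, ?_⟩, ?_⟩
    · have := hx.1.mul hy.1
      exact this
    · rw [iccDeriv_zero]
      exact ⟨_, by rintro _ ⟨p, rfl⟩; exact hq p⟩
    · rw [holderNorm_zero_eq]
      have h1 := hsup 0 x y hx hy
      have h2 := Real.iSup_le hq (mul_nonneg zero_le_two
        (mul_nonneg (holderNorm_nonneg h) (holderNorm_nonneg h)))
      linarith
  | succ n ih =>
    obtain ⟨C, hC, H⟩ := ih
    have hb : (0 : ℝ) ≤ (b - a) ^ (1 - α) := Real.rpow_nonneg (sub_nonneg.2 h.le) _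
    set D := 1 + (b - a) ^ (1 - α)
    have hD : 0 ≤ D := by positivity
    refine ⟨1 + 2 * (C * D), by positivity, fun x y hx hy => ?_⟩
    obtain ⟨hxd, hx'⟩ := (memHolderSpace_succ_iff h).1 hx
    obtain ⟨hyd, hy'⟩ := (memHolderSpace_succ_iff h).1 hy
    obtain ⟨hd, he⟩ := iccDeriv_one_mul h hxd hyd
    obtain ⟨m1, e1⟩ := H _ _ hx' (hy.of_succ hα)
    obtain ⟨m2, e2⟩ := H _ _ (hx.of_succ hα) hy'
    refine ⟨(memHolderSpace_succ_iff h).2 ⟨hd, he ▸ m1.add m2⟩, ?_⟩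
    have h1 := hsup (n + 1) x y hx hy
    have h2 := m1.norm_add_le m2
    have nx : holderNorm h n α (iccDeriv h 1 x) ≤ holderNorm h (n + 1) α x :=
      holderNorm_iccDeriv_le h 1 n x
    have ny : holderNorm h n α (iccDeriv h 1 y) ≤ holderNorm h (n + 1) α y :=
      holderNorm_iccDeriv_le h 1 n y
    have b1 : C * holderNorm h n α (iccDeriv h 1 x) * holderNorm h n α y ≤
        C * holderNorm h (n + 1) α x * (D * holderNorm h (n + 1) α y) :=
      mul_le_mul (mul_le_mul_of_nonneg_left nx hC) (hy.norm_le_succ hα) (holderNorm_nonneg h)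
        (mul_nonneg hC (holderNorm_nonneg h))
    have b2 : C * holderNorm h n α x * holderNorm h n α (iccDeriv h 1 y) ≤
        C * (D * holderNorm h (n + 1) α x) * holderNorm h (n + 1) α y :=
      mul_le_mul (mul_le_mul_of_nonneg_left (hx.norm_le_succ hα) hC) ny (holderNorm_nonneg h)
        (mul_nonneg hC (mul_nonneg hD (holderNorm_nonneg h)))
    rw [holderNorm_succ, he]
    nlinarith

/-- The primitive of `u` that vanishes at `a`. -/
noncomputable def iccInt (u : Icc a b → ℂ) : Icc a b → ℂ :=
  fun t => ∫ s in a..t, IccExtend h.le u s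

theorem iccInt_left (u : Icc a b → ℂ) : iccInt h u ⟨a, left_mem_Icc.2 h.le⟩ = 0 := by
  simp [iccInt]

theorem hasDerivWithinAt_iccInt {u : Icc a b → ℂ} (hu : Continuous u) (t : Icc a b) :
    HasDerivWithinAt (IccExtend h.le (iccInt h u)) (u t) (Icc a b) t := by
  have hc : Continuous (IccExtend h.le u) := hu.Icc_extend'
  have h1 : HasDerivAt (fun s => ∫ s in a..s, IccExtend h.le u s) (IccExtend h.le u t) t :=
    hc.integral_hasStrictDerivAt a t |>.hasDerivAt
  rw [IccExtend_val] at h1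
  refine h1.hasDerivWithinAt.congr_of_mem (fun s hs => ?_) t.2
  rw [IccExtend_of_mem h.le _ hs]
  rfl

theorem iccDeriv_one_iccInt {u : Icc a b → ℂ} (hu : Continuous u) :
    iccDeriv h 1 (iccInt h u) = u :=
  iccDeriv_one_eq h (hasDerivWithinAt_iccInt h hu)

theorem MemHolderSpace.iccInt_mem {h : a < b} {u : Icc a b → ℂ} (hu : MemHolderSpace h n α u) :
    MemHolderSpace h (n + 1) α (iccInt h u) :=
  (memHolderSpace_succ_iff h).2 ⟨differentiableOn_of_hasDerivWithinAt h
    (hasDerivWithinAt_iccInt h hu.continuous), by rwa [iccDeriv_one_iccInt h hu.continuous]⟩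

theorem norm_iccInt_le {u : Icc a b → ℂ} {C : ℝ} (hu : ∀ t, ‖u t‖ ≤ C) (t : Icc a b) :
    ‖iccInt h u t‖ ≤ C * (b - a) := by
  have hC : 0 ≤ C := (norm_nonneg _).trans (hu t)
  refine (intervalIntegral.norm_integral_le_of_norm_le_const (C := C) fun s _ => hu _).trans ?_
  rw [abs_of_nonneg (sub_nonneg.2 t.2.1)]
  exact mul_le_mul_of_nonneg_left (by linarith [t.2.2]) hC

/-- The primitive of a merely continuous function is Lipschitz. This gives the first gain of
regularity when the solution of the Volterra equation is bootstrapped. -/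
theorem memHolderSpace_zero_iccInt (hα : α ≤ 1) {u : Icc a b → ℂ} (hu : Continuous u) :
    MemHolderSpace h 0 α (iccInt h u) := by
  obtain ⟨C, hC⟩ := isCompact_univ.exists_bound_of_continuousOn hu.continuousOn
  have hC0 : 0 ≤ C := (norm_nonneg _).trans (hC ⟨a, left_mem_Icc.2 h.le⟩ trivial)
  exact memHolderSpace_zero_of_lipschitz h hα hC0
    (lipschitz_of_hasDerivWithinAt h (hasDerivWithinAt_iccInt h hu) fun t => hC t trivial)

theorem continuous_iccInt {u : Icc a b → ℂ} (hu : Continuous u) : Continuous (iccInt h u) :=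
  (memHolderSpace_zero_iccInt h le_rfl hu).continuous

theorem eq_of_iccDeriv_one_eq (hx : DifferentiableOn ℝ (IccExtend h.le x) (Icc a b))
    (hy : DifferentiableOn ℝ (IccExtend h.le y) (Icc a b))
    (hd : iccDeriv h 1 x = iccDeriv h 1 y)
    (ha : x ⟨a, left_mem_Icc.2 h.le⟩ = y ⟨a, left_mem_Icc.2 h.le⟩) : x = y := by
  have key : ∀ t : Icc a b, HasDerivWithinAt (IccExtend h.le (x - y)) 0 (Icc a b) t := by
    intro t
    have := (hasDerivWithinAt_iccDeriv h hx t).sub (hasDerivWithinAt_iccDeriv h hy t)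
    rw [hd, sub_self] at this
    exact this
  funext t
  have := lipschitz_of_hasDerivWithinAt h (x' := 0) key (C := 0) (by simp)
    ⟨a, left_mem_Icc.2 h.le⟩ t
  rw [zero_mul, norm_le_zero_iff, Pi.sub_apply, Pi.sub_apply, ha, sub_self, sub_zero] at this
  exact sub_eq_zero.1 this

end HolderCalculus

/-! ### Evaluation, differentiation and multiplication as bounded operators. -/

namespace HolderSpace

variable {a b : ℝ} {h : a < b} {n : ℕ} {α : ℝ}

/-- A function in `C^{n,α}` as an element of the Hölder space. -/
def ofMem (x : Icc a b → ℂ) (hx : MemHolderSpace h n α x) : HolderSpace h n α := ⟨x, hx⟩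

@[simp] theorem ofMem_toFun (x : Icc a b → ℂ) (hx : MemHolderSpace h n α x) :
    (ofMem x hx).toFun = x := rfl

@[simp] theorem toFun_add (x y : HolderSpace h n α) : (x + y).toFun = x.toFun + y.toFun := rfl

@[simp] theorem toFun_zero : (0 : HolderSpace h n α).toFun = 0 := rfl

@[simp] theorem toFun_sub (x y : HolderSpace h n α) : (x - y).toFun = x.toFun - y.toFun := rfl

theorem toFun_injective : Function.Injective (toFun : HolderSpace h n α → Icc a b → ℂ) :=
  Subtype.val_injective

variable (h n α) in
/-- The underlying function as a linear map. -/
def toFunₗ : HolderSpace h n α →ₗ[ℂ] Icc a b → ℂ where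
  toFun := toFun
  map_add' _ _ := rfl
  map_smul' _ _ := rfl

theorem toFun_sum {ι : Type*} (s : Finset ι) (f : ι → HolderSpace h n α) :
    (∑ i ∈ s, f i).toFun = ∑ i ∈ s, (f i).toFun :=
  map_sum (toFunₗ h n α) f s

theorem norm_apply_le (x : HolderSpace h n α) (t : Icc a b) : ‖x t‖ ≤ ‖x‖ :=
  (mem x).norm_apply_le t

variable (h n α) in
/-- Evaluation at a point. -/
noncomputable def evalCLM (t : Icc a b) : HolderSpace h n α →L[ℂ] ℂ :=
  LinearMap.mkContinuous
    { toFun := fun x => x t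
      map_add' := fun _ _ => rfl
      map_smul' := fun _ _ => rfl } 1 fun x => by
    rw [one_mul]
    exact norm_apply_le x t

@[simp] theorem evalCLM_apply (t : Icc a b) (x : HolderSpace h n α) :
    evalCLM h n α t x = x t := rfl

variable (h) in
/-- The operator `x ↦ x^{(j)}` from `C^{N,α}` to `C^{k,α}`, where `k + j ≤ N`. -/
noncomputable def derivCLM (hα : α ≤ 1) {j k N : ℕ} (hN : k + j ≤ N) :
    HolderSpace h N α →L[ℂ] HolderSpace h k α :=
  LinearMap.mkContinuous
    { toFun := fun x => ofMem (iccDeriv h j x.toFun) ((mem x).of_le hα hN).iccDeriv_mem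
      map_add' := fun x y => toFun_injective (iccDeriv_add h
        ((mem x).contDiffOn (le_of_add_le_right hN)) ((mem y).contDiffOn (le_of_add_le_right hN)))
      map_smul' := fun c x => toFun_injective (iccDeriv_smul h c
        ((mem x).contDiffOn (le_of_add_le_right hN))) }
    (exists_holderNorm_le_of_le h hα hN).choose fun x =>
      (holderNorm_iccDeriv_le h j k x.toFun).trans
        ((exists_holderNorm_le_of_le h hα hN).choose_spec.2 _ (mem x))

@[simp] theorem derivCLM_toFun (hα : α ≤ 1) {j k N : ℕ} (hN : k + j ≤ N)
    (x : HolderSpace h N α) : (derivCLM h hα hN x).toFun = iccDeriv h j x.toFun := rfl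

variable (h n) in
/-- Pointwise multiplication in `C^{n,α}`. -/
noncomputable def mulCLM (hα : α ≤ 1) :
    HolderSpace h n α →L[ℂ] HolderSpace h n α →L[ℂ] HolderSpace h n α :=
  LinearMap.mkContinuous₂
    (LinearMap.mk₂ ℂ
      (fun x y => ofMem (x.toFun * y.toFun)
        ((exists_holderNorm_mul_le h hα n).choose_spec.2 _ _ (mem x) (mem y)).1)
      (fun _ _ _ => toFun_injective (add_mul _ _ _))
      (fun _ _ _ => toFun_injective (smul_mul_assoc _ _ _))
      (fun _ _ _ => toFun_injective (mul_add _ _ _))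
      (fun _ _ _ => toFun_injective (mul_smul_comm _ _ _)))
    (exists_holderNorm_mul_le h hα n).choose fun x y =>
      ((exists_holderNorm_mul_le h hα n).choose_spec.2 _ _ (mem x) (mem y)).2

@[simp] theorem mulCLM_toFun (hα : α ≤ 1) (x y : HolderSpace h n α) :
    (mulCLM h n hα x y).toFun = x.toFun * y.toFun := rfl

end HolderSpace

/-! ### Integration as an operator, and completeness of the Hölder spaces. -/

section Integral

variable {a b : ℝ} (h : a < b) {n : ℕ} {α : ℝ}

theorem iccInt_add {u v : Icc a b → ℂ} (hu : Continuous u) (hv : Continuous v) :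
    iccInt h (u + v) = iccInt h u + iccInt h v := by
  funext t
  exact intervalIntegral.integral_add (hu.Icc_extend'.intervalIntegrable _ _)
    (hv.Icc_extend'.intervalIntegrable _ _)

theorem iccInt_smul (c : ℂ) (u : Icc a b → ℂ) : iccInt h (c • u) = c • iccInt h u := by
  funext t
  exact intervalIntegral.integral_smul c _

end Integral

namespace HolderSpace

variable {a b : ℝ} {h : a < b} {n : ℕ} {α : ℝ}

variable (h n α) in
/-- The primitive vanishing at `a`, as an operator from `C^{n,α}` to `C^{n+1,α}`. -/
noncomputable def intCLM : HolderSpace h n α →L[ℂ] HolderSpace h (n + 1) α :=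
  LinearMap.mkContinuous
    { toFun := fun u => ofMem (iccInt h u.toFun) (mem u).iccInt_mem
      map_add' := fun u v => toFun_injective (iccInt_add h (mem u).continuous (mem v).continuous)
      map_smul' := fun c u => toFun_injective (iccInt_smul h c u.toFun) }
    ((b - a) + 1) fun u => by
      change holderNorm h (n + 1) α (iccInt h u.toFun) ≤ _
      rw [holderNorm_succ, iccDeriv_one_iccInt h (mem u).continuous, add_mul, one_mul]
      refine add_le_add (Real.iSup_le (fun t => ?_)
        (mul_nonneg (sub_nonneg.2 h.le) (norm_nonneg _))) le_rfl
      rw [mul_comm]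
      exact norm_iccInt_le h (norm_apply_le u) t

@[simp] theorem intCLM_toFun (u : HolderSpace h n α) :
    (intCLM h n α u).toFun = iccInt h u.toFun := rfl

variable (h n α) in
/-- The constant function. -/
noncomputable def constCLM : ℂ →L[ℂ] HolderSpace h n α :=
  LinearMap.toContinuousLinearMap
    { toFun := fun c => ofMem (fun _ => c) (by
        have h1 : ∀ m : ℕ, MemHolderSpace h m α (fun _ : Icc a b => c) := by
          intro m
          have hd : ∀ t : Icc a b,
              HasDerivWithinAt (IccExtend h.le fun _ : Icc a b => c) 0 (Icc a b) t :=
            fun t => hasDerivWithinAt_const _ _ c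
          cases m with
          | zero =>
            refine ⟨contDiffOn_const, 0, ?_⟩
            rintro _ ⟨p, rfl⟩
            simp [iccDeriv_zero, holderQuot]
          | succ m =>
            refine (memHolderSpace_succ_iff h).2 ⟨differentiableOn_of_hasDerivWithinAt h
              (x' := 0) hd, ?_⟩
            rw [iccDeriv_one_eq h (x' := 0) hd]
            exact memHolderSpace_zero h
        exact h1 n)
      map_add' := fun _ _ => rfl
      map_smul' := fun _ _ => rfl }

@[simp] theorem constCLM_toFun (c : ℂ) : (constCLM h n α c).toFun = fun _ => c := rfl

theorem eq_const_add_int (x : HolderSpace h (n + 1) α) {u : HolderSpace h n α}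
    (hu : iccDeriv h 1 x.toFun = u.toFun) :
    x = constCLM h (n + 1) α (x ⟨a, left_mem_Icc.2 h.le⟩) + intCLM h n α u := by
  have hd : ∀ y : HolderSpace h (n + 1) α,
      DifferentiableOn ℝ (IccExtend h.le y.toFun) (Icc a b) :=
    fun y => ((memHolderSpace_succ_iff h).1 (mem y)).1
  refine toFun_injective (eq_of_iccDeriv_one_eq h (hd _) (hd _) ?_ ?_)
  · rw [hu, toFun_add, iccDeriv_add h ((mem _).contDiffOn (by omega))
      ((mem _).contDiffOn (by omega)), intCLM_toFun,
      iccDeriv_one_iccInt h (mem u).continuous, constCLM_toFun,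
      iccDeriv_one_eq h (x' := 0) fun t => hasDerivWithinAt_const _ _ _, zero_add]
  · simp [iccInt_left]

variable (h n) in
/-- `C^{n+1,α}` is isomorphic to `ℂ × C^{n,α}` through `x ↦ (x(a), x')`. -/
noncomputable def succEquiv (hα : α ≤ 1) :
    HolderSpace h (n + 1) α ≃L[ℂ] ℂ × HolderSpace h n α :=
  ContinuousLinearEquiv.equivOfInverse
    ((evalCLM h (n + 1) α ⟨a, left_mem_Icc.2 h.le⟩).prod (derivCLM h hα (le_refl (n + 1))))
    ((constCLM h (n + 1) α).coprod (intCLM h n α))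
    (fun x => (eq_const_add_int x rfl).symm)
    (fun p => by
      refine Prod.ext ?_ (toFun_injective ?_)
      · simp [iccInt_left]
      · simp only [ContinuousLinearMap.prod_apply, ContinuousLinearMap.coprod_apply,
          derivCLM_toFun, toFun_add]
        rw [iccDeriv_add h ((mem _).contDiffOn (by omega)) ((mem _).contDiffOn (by omega)),
          intCLM_toFun, iccDeriv_one_iccInt h (mem p.2).continuous, constCLM_toFun,
          iccDeriv_one_eq h (x' := 0) fun t => hasDerivWithinAt_const _ _ _, zero_add])

/-- A Cauchy sequence converges pointwise, and the bounds `β k` on values and on Hölder quotients of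
differences `u k - u l` survive the limit in `l` at each point and each pair. The same bounds show
that the limit belongs to the space and that the convergence is in norm. -/
theorem completeSpace_zero : CompleteSpace (HolderSpace h 0 α) := by
  refine Metric.complete_of_cauchySeq_tendsto fun u hu => ?_
  obtain ⟨β, hβ0, hβ, hβt⟩ := cauchySeq_iff_le_tendsto_0.1 hu
  have hd : ∀ k l t, ‖u k t - u l t‖ ≤ ‖u k - u l‖ := fun k l t => norm_apply_le (u k - u l) t
  have hlim : ∀ t, ∃ c, Tendsto (fun k => u k t) atTop (𝓝 c) := fun t =>
    cauchySeq_tendsto_of_complete (cauchySeq_iff_le_tendsto_0.2 ⟨β, hβ0, fun k l N hk hl => by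
      rw [dist_eq_norm]
      refine (hd k l t).trans ?_
      rw [← dist_eq_norm]
      exact hβ k l N hk hl, hβt⟩)
  choose x hx using hlim
  have hs : ∀ k t, ‖u k t - x t‖ ≤ β k := fun k t =>
    le_of_tendsto ((tendsto_const_nhds.sub (hx t)).norm) <| by
      filter_upwards [eventually_ge_atTop k] with l hl
      refine (hd k l t).trans ?_
      rw [← dist_eq_norm]
      exact hβ k l k le_rfl hl
  have hq : ∀ k p, holderQuot α ((u k).toFun - x) p ≤ β k := by
    intro k p
    have : Tendsto (fun l => holderQuot α ((u k).toFun - (u l).toFun) p) atTop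
        (𝓝 (holderQuot α ((u k).toFun - x) p)) := by
      simp only [holderQuot, Pi.sub_apply]
      exact (((tendsto_const_nhds.sub (hx _)).sub
        (tendsto_const_nhds.sub (hx _))).norm).div_const _
    refine le_of_tendsto this ?_
    filter_upwards [eventually_ge_atTop k] with l hl
    refine ((mem (u k - u l)).holderQuot_le p).trans ?_
    change ‖u k - u l‖ ≤ _
    rw [← dist_eq_norm]
    exact hβ k l k le_rfl hl
  have hcont : Continuous x := by
    have hU : TendstoUniformly (fun k => (u k).toFun) x atTop := by
      rw [Metric.tendstoUniformly_iff]
      intro ε hε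
      filter_upwards [hβt.eventually_lt_const hε] with k hk t
      rw [dist_comm, dist_eq_norm]
      exact (hs k t).trans_lt hk
    exact hU.continuous (Frequently.of_forall fun k => (mem (u k)).continuous)
  have hmemd : ∀ k, MemHolderSpace h 0 α ((u k).toFun - x) := fun k => by
    constructor
    · have := (((mem (u k)).continuous.sub hcont).Icc_extend' (h := h.le))
      simpa using this.continuousOn
    · rw [iccDeriv_zero]
      exact ⟨β k, by rintro _ ⟨p, rfl⟩; exact hq k p⟩
  have hmem : MemHolderSpace h 0 α x := by
    have := (mem (u 0)).add ((hmemd 0).smul (-1))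
    simpa using this
  refine ⟨ofMem x hmem, tendsto_iff_norm_sub_tendsto_zero.2 ?_⟩
  refine squeeze_zero (fun _ => norm_nonneg _) (g := fun k => β k + β k) (fun k => ?_)
    (by simpa using hβt.add hβt)
  change holderNorm h 0 α ((u k).toFun - x) ≤ _
  rw [holderNorm_zero_eq]
  exact add_le_add (Real.iSup_le (hs k) (hβ0 k)) (Real.iSup_le (hq k) (hβ0 k))

theorem completeSpace (hα : α ≤ 1) : CompleteSpace (HolderSpace h n α) := by
  induction n with
  | zero => exact completeSpace_zero
  | succ n ih =>
    have e := succEquiv h n hα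
    exact (completeSpace_congr (e := e.toLinearEquiv.toEquiv) e.isUniformEmbedding).2 inferInstance

end HolderSpace

/-! ### Volterra equations in continuous functions. -/

/-- The unit `1 - (-x)^j` is the product of `1 + x` and a geometric sum. The two factors commute, so
each of them is a unit. -/
theorem isUnit_one_add_of_norm_pow_lt_one {R : Type*} [NormedRing R] [CompleteSpace R] {x : R}
    {j : ℕ} (hx : ‖x ^ j‖ < 1) : IsUnit (1 + x) := by
  have hu : IsUnit (1 - (-x) ^ j) := by
    refine isUnit_one_sub_of_norm_lt_one ?_
    rcases Nat.even_or_odd j with e | e <;> simpa [e.neg_pow] using hx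
  rw [← mul_neg_geom_sum] at hu
  have hcomm : Commute (1 - -x) (∑ i ∈ Finset.range j, (-x) ^ i) :=
    Commute.sum_right _ _ _ fun i _ =>
      ((Commute.one_left _).sub_left (Commute.refl _)).pow_right i
  simpa using (hcomm.isUnit_mul_iff.1 hu).1

section Volterra

variable {a b : ℝ} (h : a < b)

/-- The primitive vanishing at `a`, as an operator on continuous functions. -/
noncomputable def continuousIntCLM : C(Icc a b, ℂ) →L[ℂ] C(Icc a b, ℂ) :=
  LinearMap.mkContinuous
    { toFun := fun u => ⟨iccInt h u, continuous_iccInt h u.continuous⟩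
      map_add' := fun u v => ContinuousMap.ext fun t =>
        congrFun (iccInt_add h u.continuous v.continuous) t
      map_smul' := fun c u => ContinuousMap.ext fun t => congrFun (iccInt_smul h c u) t }
    (b - a) fun u => (ContinuousMap.norm_le _
      (mul_nonneg (sub_nonneg.2 h.le) (norm_nonneg _))).2 fun t => by
        rw [mul_comm]
        exact norm_iccInt_le h u.norm_coe_le_norm t

theorem continuousIntCLM_iterate_coe (j : ℕ) (u : C(Icc a b, ℂ)) :
    ⇑((continuousIntCLM h)^[j] u) = (iccInt h)^[j] u := by
  induction j with
  | zero => rfl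
  | succ j ih =>
    rw [Function.iterate_succ_apply', Function.iterate_succ_apply', ← ih]
    rfl

/-- In the sup norm weighted by `exp (-λ (t - a))`, integration from `a` has norm at most `1/λ`, so
a large `λ` makes it as small as desired. -/
theorem norm_iccInt_le_exp {u : Icc a b → ℂ} {c lam : ℝ} (hlam : 0 < lam)
    (hu : ∀ t : Icc a b, ‖u t‖ ≤ c * Real.exp (lam * (t - a))) (t : Icc a b) :
    ‖iccInt h u t‖ ≤ c / lam * Real.exp (lam * (t - a)) := by
  have hc : 0 ≤ c := by
    have := (norm_nonneg _).trans (hu ⟨a, left_mem_Icc.2 h.le⟩)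
    simpa using this
  have hcont : Continuous fun s : ℝ => c * Real.exp (lam * (s - a)) := by fun_prop
  have hder : ∀ s : ℝ, HasDerivAt (fun s : ℝ => c / lam * Real.exp (lam * (s - a)))
      (c * Real.exp (lam * (s - a))) s := by
    intro s
    have := ((((hasDerivAt_id s).sub_const a).const_mul lam).exp).const_mul (c / lam)
    refine this.congr_deriv ?_
    simp only [id]
    field_simp
  calc ‖iccInt h u t‖ ≤ ∫ s in a..t, c * Real.exp (lam * (s - a)) := by
        refine intervalIntegral.norm_integral_le_of_norm_le t.2.1
          (Eventually.of_forall fun s hs => ?_) (hcont.intervalIntegrable _ _)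
        have hs' : s ∈ Icc a b := ⟨hs.1.le, hs.2.trans t.2.2⟩
        rw [IccExtend_of_mem h.le _ hs']
        exact hu ⟨s, hs'⟩
    _ = c / lam * Real.exp (lam * (t - a)) - c / lam := by
        rw [intervalIntegral.integral_eq_sub_of_hasDerivAt (fun s _ => hder s)
          (hcont.intervalIntegrable _ _)]
        simp
    _ ≤ _ := sub_le_self _ (by positivity)

theorem norm_iccInt_iterate_le_exp {u : Icc a b → ℂ} {c lam : ℝ} (hlam : 1 ≤ lam)
    (hu : ∀ t : Icc a b, ‖u t‖ ≤ c * Real.exp (lam * (t - a))) {j : ℕ} (hj : 1 ≤ j)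
    (t : Icc a b) : ‖(iccInt h)^[j] u t‖ ≤ c / lam * Real.exp (lam * (t - a)) := by
  have hlam0 : 0 < lam := zero_lt_one.trans_le hlam
  have hc : 0 ≤ c := by
    have := (norm_nonneg _).trans (hu ⟨a, left_mem_Icc.2 h.le⟩)
    simpa using this
  induction j, hj using Nat.le_induction generalizing t with
  | base => exact norm_iccInt_le_exp h hlam0 hu t
  | succ j _ ih =>
    rw [Function.iterate_succ_apply']
    refine (norm_iccInt_le_exp h hlam0 ih t).trans ?_
    gcongr
    exact div_le_self (by positivity) hlam

variable {ι : Type*} [Fintype ι] {r : ℕ}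

/-- The Volterra operator `u ↦ ∑_l A_l J^{r-l} u`, with `J` the integration from `a`. -/
noncomputable def volterraCLM (A : Fin r → ι → ι → C(Icc a b, ℂ)) :
    (ι → C(Icc a b, ℂ)) →L[ℂ] (ι → C(Icc a b, ℂ)) :=
  ContinuousLinearMap.pi fun i => ∑ l : Fin r, ∑ k, (ContinuousLinearMap.mul ℂ _ (A l i k)).comp
    ((continuousIntCLM h ^ (r - l : ℕ)).comp (ContinuousLinearMap.proj k))

theorem volterraCLM_apply (A : Fin r → ι → ι → C(Icc a b, ℂ)) (u : ι → C(Icc a b, ℂ)) (i : ι)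
    (t : Icc a b) : volterraCLM h A u i t =
      ∑ l : Fin r, ∑ k, A l i k t * (iccInt h)^[r - l] (u k) t := by
  simp [volterraCLM, ContinuousMap.sum_apply, continuousIntCLM_iterate_coe]

/-- Every summand contains at least one integration, since `r - l ≥ 1`. In a suitable exponentially
weighted norm the operator therefore has norm at most `1/2`; returning to the sup norm costs only
the fixed factor `exp (λ (b - a))`, so some power has norm below `1`. -/
theorem isUnit_one_add_volterraCLM (A : Fin r → ι → ι → C(Icc a b, ℂ)) :
    IsUnit (1 + volterraCLM h A) := by
  set M : ℝ := ∑ i, ∑ l : Fin r, ∑ k, ‖A l i k‖ with hM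
  have hM0 : 0 ≤ M := by positivity
  -- This choice gives both `M / λ ≤ 1/2` and `λ ≥ 1`; the latter lets all integrations after the
  -- first be estimated by `1`.
  set lam : ℝ := 2 * M + 1 with hlam
  have hlam1 : 1 ≤ lam := by linarith
  have step : ∀ (u : ι → C(Icc a b, ℂ)) (c : ℝ), 0 ≤ c →
      (∀ i (t : Icc a b), ‖u i t‖ ≤ c * Real.exp (lam * (t - a))) →
      ∀ i (t : Icc a b), ‖volterraCLM h A u i t‖ ≤ c / 2 * Real.exp (lam * (t - a)) := by
    intro u c hc hu i t
    rw [volterraCLM_apply]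
    calc _ ≤ ∑ l : Fin r, ∑ k, ‖A l i k‖ * (c / lam * Real.exp (lam * (t - a))) := by
          refine (norm_sum_le _ _).trans (Finset.sum_le_sum fun l _ =>
            (norm_sum_le _ _).trans (Finset.sum_le_sum fun k _ => ?_))
          rw [norm_mul]
          exact mul_le_mul ((A l i k).norm_coe_le_norm t)
            (norm_iccInt_iterate_le_exp h hlam1 (hu k) (by omega) t) (norm_nonneg _)
            (norm_nonneg _)
      _ = (∑ l : Fin r, ∑ k, ‖A l i k‖) * (c / lam * Real.exp (lam * (t - a))) := by
          simp only [Finset.sum_mul]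
      _ ≤ M * (c / lam * Real.exp (lam * (t - a))) := by
          refine mul_le_mul_of_nonneg_right ?_ (by positivity)
          exact Finset.single_le_sum (f := fun i => ∑ l : Fin r, ∑ k, ‖A l i k‖)
            (fun i _ => by positivity) (Finset.mem_univ i)
      _ = (M / lam) * (c * Real.exp (lam * (t - a))) := by ring
      _ ≤ (1 / 2) * (c * Real.exp (lam * (t - a))) := by
          refine mul_le_mul_of_nonneg_right ?_ (by positivity)
          rw [div_le_iff₀ (by positivity)]
          linarith
      _ = _ := by ring
  have iter : ∀ (j : ℕ) (u : ι → C(Icc a b, ℂ)) (i) (t : Icc a b),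
      ‖(volterraCLM h A ^ j) u i t‖ ≤ ‖u‖ / 2 ^ j * Real.exp (lam * (t - a)) := by
    intro j u
    induction j with
    | zero =>
      intro i t
      have h1 : ‖u i t‖ ≤ ‖u‖ := ((u i).norm_coe_le_norm t).trans (norm_le_pi_norm u i)
      have h2 : (1 : ℝ) ≤ Real.exp (lam * (t - a)) :=
        Real.one_le_exp (mul_nonneg (by linarith) (sub_nonneg.2 t.2.1))
      simpa using h1.trans (le_mul_of_one_le_right (norm_nonneg _) h2)
    | succ j ih =>
      intro i t
      rw [pow_succ', pow_succ, ← div_div]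
      exact step _ _ (by positivity) ih i t
  have hnorm : ∀ j : ℕ, ‖volterraCLM h A ^ j‖ ≤ Real.exp (lam * (b - a)) * (1 / 2) ^ j := by
    intro j
    refine ContinuousLinearMap.opNorm_le_bound _ (by positivity) fun u => ?_
    refine (pi_norm_le_iff_of_nonneg (by positivity)).2 fun i =>
      (ContinuousMap.norm_le _ (by positivity)).2 fun t => (iter j u i t).trans ?_
    have : Real.exp (lam * (t - a)) ≤ Real.exp (lam * (b - a)) := by
      have := t.2.2
      gcongr
    calc _ ≤ ‖u‖ / 2 ^ j * Real.exp (lam * (b - a)) := by gcongr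
      _ = _ := by
        rw [one_div, inv_pow]
        ring
  obtain ⟨j, hj⟩ : ∃ j : ℕ, Real.exp (lam * (b - a)) * (1 / 2) ^ j < 1 := by
    have : Tendsto (fun j : ℕ => Real.exp (lam * (b - a)) * (1 / 2 : ℝ) ^ j) atTop (𝓝 0) := by
      simpa using (tendsto_pow_atTop_nhds_zero_of_lt_one (r := (1 / 2 : ℝ))
        (by norm_num) (by norm_num)).const_mul (Real.exp (lam * (b - a)))
    exact (this.eventually_lt_const zero_lt_one).exists
  exact isUnit_one_add_of_norm_pow_lt_one
    (R := (ι → C(Icc a b, ℂ)) →L[ℂ] (ι → C(Icc a b, ℂ))) ((hnorm j).trans_lt hj)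

end Volterra

/-! ### Iterated integrals and monomials. -/

section IteratedIntegral

variable {a b : ℝ} {h : a < b} {n : ℕ} {α : ℝ}

theorem MemHolderSpace.mul {x y : Icc a b → ℂ} (hα : α ≤ 1) (hx : MemHolderSpace h n α x)
    (hy : MemHolderSpace h n α y) : MemHolderSpace h n α (x * y) :=
  ((exists_holderNorm_mul_le h hα n).choose_spec.2 _ _ hx hy).1

theorem memHolderSpace_sum {ι : Type*} {s : Finset ι} {x : ι → Icc a b → ℂ}
    (hx : ∀ i ∈ s, MemHolderSpace h n α (x i)) : MemHolderSpace h n α (∑ i ∈ s, x i) :=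
  (holderSubmodule h n α).sum_mem hx

theorem continuous_iccInt_iterate {u : Icc a b → ℂ} (hu : Continuous u) (j : ℕ) :
    Continuous ((iccInt h)^[j] u) := by
  induction j with
  | zero => exact hu
  | succ j ih =>
    rw [Function.iterate_succ_apply']
    exact continuous_iccInt h ih

theorem memHolderSpace_zero_iccInt_iterate (hα : α ≤ 1) {u : Icc a b → ℂ} (hu : Continuous u)
    {j : ℕ} (hj : 1 ≤ j) : MemHolderSpace h 0 α ((iccInt h)^[j] u) := by
  obtain ⟨j, rfl⟩ := Nat.exists_eq_add_of_le' hj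
  rw [Function.iterate_succ_apply']
  exact memHolderSpace_zero_iccInt h hα (continuous_iccInt_iterate hu j)

theorem MemHolderSpace.iccInt_iterate {u : Icc a b → ℂ} (hu : MemHolderSpace h n α u) (j : ℕ) :
    MemHolderSpace h (n + j) α ((iccInt h)^[j] u) := by
  induction j with
  | zero => exact hu
  | succ j ih =>
    rw [Function.iterate_succ_apply']
    exact ih.iccInt_mem

theorem iccDeriv_iccInt_iterate {u : Icc a b → ℂ} (hu : Continuous u) {l r : ℕ} (hl : l ≤ r) :
    iccDeriv h l ((iccInt h)^[r] u) = (iccInt h)^[r - l] u := by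
  induction r generalizing l with
  | zero =>
    obtain rfl := Nat.le_zero.1 hl
    exact iccDeriv_zero h _
  | succ r ih =>
    cases l with
    | zero => exact iccDeriv_zero h _
    | succ l =>
      rw [iccDeriv_succ, Function.iterate_succ_apply',
        iccDeriv_one_iccInt h (continuous_iccInt_iterate hu r), ih (by omega),
        Nat.add_sub_add_right]

end IteratedIntegral

namespace HolderSpace

variable {a b : ℝ} {h : a < b} {n : ℕ} {α : ℝ}

variable (h n α) in
/-- The `r`-fold integration from `a`, as an operator from `C^{n,α}` to `C^{n+r,α}`. -/
noncomputable def intIterCLM : (r : ℕ) → HolderSpace h n α →L[ℂ] HolderSpace h (n + r) α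
  | 0 => ContinuousLinearMap.id ℂ _
  | r + 1 => (intCLM h (n + r) α).comp (intIterCLM r)

@[simp] theorem intIterCLM_toFun (r : ℕ) (u : HolderSpace h n α) :
    (intIterCLM h n α r u).toFun = (iccInt h)^[r] u.toFun := by
  induction r with
  | zero => rfl
  | succ r ih =>
    rw [Function.iterate_succ_apply', ← ih]
    rfl

/-- Taylor's formula without polynomial part. The induction peels off one integration and applies
the hypothesis to `x'`, whose derivatives at `a` vanish up to order `r - 1`. -/
theorem eq_intIterCLM (hα : α ≤ 1) {r : ℕ} (x : HolderSpace h (n + r) α)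
    (hx : ∀ l < r, iccDeriv h l x.toFun ⟨a, left_mem_Icc.2 h.le⟩ = 0) :
    x = intIterCLM h n α r (derivCLM h hα le_rfl x) := by
  induction r with
  | zero => exact toFun_injective (iccDeriv_zero h _).symm
  | succ r ih =>
    have e := eq_const_add_int (n := n + r) x
      (u := derivCLM h hα (j := 1) (N := n + (r + 1)) le_rfl x) rfl
    have h0 : x ⟨a, left_mem_Icc.2 h.le⟩ = 0 := by
      have := hx 0 (by omega)
      rwa [iccDeriv_zero] at this
    rw [h0, map_zero, zero_add, ih (derivCLM h hα (j := 1) (N := n + (r + 1)) le_rfl x)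
      (fun l hl => by rw [derivCLM_toFun, ← iccDeriv_succ]; exact hx _ (by omega))] at e
    have e' : derivCLM h hα (k := n) (le_refl (n + r))
        (derivCLM h hα (j := 1) (k := n + r) (N := n + (r + 1)) le_rfl x) =
        derivCLM h hα (j := r + 1) le_rfl x := toFun_injective (by
      simp only [derivCLM_toFun]
      exact (iccDeriv_succ h r _).symm)
    rw [e'] at e
    exact e

variable (h n) in
/-- The function `t ↦ (t - a)^l / l!`. -/
noncomputable def monomial (hα : α ≤ 1) (l : ℕ) : HolderSpace h n α :=
  ofMem ((iccInt h)^[l] 1)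
    (((mem (constCLM h n α 1)).iccInt_iterate l).of_le hα (Nat.le_add_right n l))

@[simp] theorem monomial_toFun (hα : α ≤ 1) (l : ℕ) :
    (monomial h n hα l).toFun = (iccInt h)^[l] 1 := rfl

variable (h) in
theorem iccDeriv_monomial_self (l : ℕ) : iccDeriv h l ((iccInt h)^[l] 1) = 1 := by
  rw [iccDeriv_iccInt_iterate continuous_one le_rfl, Nat.sub_self]
  rfl

variable (h) in
theorem iccDeriv_monomial_of_lt {l j : ℕ} (hl : l < j) :
    iccDeriv h j ((iccInt h)^[l] 1) = 0 := by
  obtain ⟨k, rfl⟩ := Nat.exists_eq_add_of_lt hl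
  rw [show l + k + 1 = (k + 1) + l by omega, iccDeriv_add_index, iccDeriv_monomial_self,
    iccDeriv_succ, iccDeriv_one_eq h (x := 1) (x' := 0) fun t => hasDerivWithinAt_const _ _ (1 : ℂ)]
  have := iccDeriv_smul h (j := k) (0 : ℂ) (mem (0 : HolderSpace h k 1)).1
  simpa using this

variable (h) in
theorem iccDeriv_monomial_left (l j : ℕ) :
    iccDeriv h j ((iccInt h)^[l] 1) ⟨a, left_mem_Icc.2 h.le⟩ = if j = l then 1 else 0 := by
  rcases lt_trichotomy j l with hj | rfl | hj
  · rw [iccDeriv_iccInt_iterate continuous_one hj.le, if_neg hj.ne]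
    obtain ⟨k, hk⟩ := Nat.exists_eq_add_of_lt hj
    rw [show l - j = k + 1 by omega, Function.iterate_succ_apply', iccInt_left]
  · rw [iccDeriv_monomial_self, if_pos rfl]
    rfl
  · rw [iccDeriv_monomial_of_lt h hj, if_neg hj.ne']
    rfl

end HolderSpace

open HolderSpace

/-! ### The differential operator, the Cauchy problem and the Fredholm alternative. -/

section Operator

variable {a b : ℝ} {h : a < b} {m r n : ℕ} {α : ℝ}

/-- The differential operator `y ↦ y^{(r)} + ∑_l A_l y^{(l)}`. -/
noncomputable def odeCLM (hα : α ≤ 1) (A : Fin r → Matrix (Fin m) (Fin m) (HolderSpace h n α)) :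
    (Fin m → HolderSpace h (n + r) α) →L[ℂ] (Fin m → HolderSpace h n α) :=
  ContinuousLinearMap.pi fun i =>
    (derivCLM h hα (le_refl (n + r))).comp (ContinuousLinearMap.proj i) +
      ∑ l : Fin r, ∑ k, (mulCLM h n hα (A l i k)).comp
        ((derivCLM h hα (Nat.add_le_add_left l.2.le n)).comp (ContinuousLinearMap.proj k))

theorem odeCLM_apply (hα : α ≤ 1) (A : Fin r → Matrix (Fin m) (Fin m) (HolderSpace h n α))
    (y : Fin m → HolderSpace h (n + r) α) (i : Fin m) (t : Icc a b) :
    odeCLM hα A y i t = iccDeriv h r (y i) t +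
      ∑ l : Fin r, ∑ k : Fin m, A l i k t * iccDeriv h l (y k) t := by
  simp [odeCLM, toFun_sum, Finset.sum_apply]

theorem isBVPSolution_iff (hα : α ≤ 1)
    {A : Fin r → Matrix (Fin m) (Fin m) (HolderSpace h n α)}
    {B : (Fin m → HolderSpace h (n + r) α) →L[ℂ] EuclideanSpace ℂ (Fin (r * m))}
    {f : Fin m → HolderSpace h n α} {c : EuclideanSpace ℂ (Fin (r * m))}
    {y : Fin m → HolderSpace h (n + r) α} :
    IsBVPSolution A B f c y ↔ odeCLM hα A y = f ∧ B y = c := by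
  refine and_congr_left fun _ => ⟨fun H => ?_, fun H t i => ?_⟩
  · exact funext fun i => toFun_injective (funext fun t => (odeCLM_apply hα A y i t).trans (H t i))
  · rw [← odeCLM_apply hα, H]

theorem odeCLM_intIterCLM_apply (hα : α ≤ 1)
    (A : Fin r → Matrix (Fin m) (Fin m) (HolderSpace h n α))
    (u : Fin m → HolderSpace h n α) (i : Fin m) (t : Icc a b) :
    odeCLM hα A (fun k => intIterCLM h n α r (u k)) i t =
      u i t + ∑ l : Fin r, ∑ k : Fin m, A l i k t * (iccInt h)^[r - l] (u k) t := by
  rw [odeCLM_apply, intIterCLM_toFun, iccDeriv_iccInt_iterate (mem _).continuous le_rfl,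
    Nat.sub_self]
  congr 1
  refine Finset.sum_congr rfl fun l _ => Finset.sum_congr rfl fun k _ => ?_
  rw [intIterCLM_toFun, iccDeriv_iccInt_iterate (mem _).continuous l.2.le]

/-- The coefficients as continuous functions. -/
def coeffContinuousMap (A : Fin r → Matrix (Fin m) (Fin m) (HolderSpace h n α)) :
    Fin r → Fin m → Fin m → C(Icc a b, ℂ) :=
  fun l i k => ⟨(A l i k).toFun, (mem (A l i k)).continuous⟩

theorem one_add_volterraCLM_apply (A : Fin r → Matrix (Fin m) (Fin m) (HolderSpace h n α))
    (u : Fin m → C(Icc a b, ℂ)) (i : Fin m) (t : Icc a b) :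
    (1 + volterraCLM h (coeffContinuousMap A)) u i t =
      u i t + ∑ l : Fin r, ∑ k : Fin m, A l i k t * (iccInt h)^[r - l] (u k) t := by
  change u i t + volterraCLM h (coeffContinuousMap A) u i t = _
  rw [volterraCLM_apply]
  rfl

/-- A Hölder solution is in particular a continuous solution of the homogeneous Volterra equation,
which has only the zero solution. -/
theorem odeCLM_intIterCLM_injective (hα : α ≤ 1)
    (A : Fin r → Matrix (Fin m) (Fin m) (HolderSpace h n α)) {u : Fin m → HolderSpace h n α}
    (hu : odeCLM hα A (fun k => intIterCLM h n α r (u k)) = 0) : u = 0 := by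
  let v : Fin m → C(Icc a b, ℂ) := fun k => ⟨(u k).toFun, (mem (u k)).continuous⟩
  have hv : (1 + volterraCLM h (coeffContinuousMap A)) v = 0 :=
    funext fun i => ContinuousMap.ext fun t => by
      rw [one_add_volterraCLM_apply]
      exact (odeCLM_intIterCLM_apply hα A u i t).symm.trans (by rw [hu]; rfl)
  obtain ⟨U, hU⟩ := isUnit_one_add_volterraCLM h (coeffContinuousMap A)
  have hv0 : v = 0 := by
    have := congrArg (fun T : (Fin m → C(Icc a b, ℂ)) →L[ℂ] (Fin m → C(Icc a b, ℂ)) => T v)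
      U.inv_mul
    rw [hU] at this
    exact this.symm.trans ((congrArg
      (fun w => (↑U⁻¹ : (Fin m → C(Icc a b, ℂ)) →L[ℂ] (Fin m → C(Icc a b, ℂ))) w) hv).trans
      (map_zero (↑U⁻¹ : (Fin m → C(Icc a b, ℂ)) →L[ℂ] (Fin m → C(Icc a b, ℂ)))))
  exact funext fun k => toFun_injective (funext fun t =>
    congrArg (fun w : Fin m → C(Icc a b, ℂ) => w k t) hv0)

/-- The Volterra equation is solved in continuous functions first. Its solution satisfies `v = f - ∑
A_l J^{r-l} v`, and since the right-hand side contains only integrals of `v`, regularity climbs one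
order at a time up to `n`. -/
theorem odeCLM_intIterCLM_surjective (hα : α ≤ 1)
    (A : Fin r → Matrix (Fin m) (Fin m) (HolderSpace h n α)) (f : Fin m → HolderSpace h n α) :
    ∃ u : Fin m → HolderSpace h n α, odeCLM hα A (fun k => intIterCLM h n α r (u k)) = f := by
  obtain ⟨U, hU⟩ := isUnit_one_add_volterraCLM h (coeffContinuousMap A)
  let g : Fin m → C(Icc a b, ℂ) := fun k => ⟨(f k).toFun, (mem (f k)).continuous⟩
  obtain ⟨v, hv⟩ : ∃ v, (1 + volterraCLM h (coeffContinuousMap A)) v = g := by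
    refine ⟨(↑U⁻¹ : (Fin m → C(Icc a b, ℂ)) →L[ℂ] (Fin m → C(Icc a b, ℂ))) g, ?_⟩
    have := congrArg (fun T : (Fin m → C(Icc a b, ℂ)) →L[ℂ] (Fin m → C(Icc a b, ℂ)) => T g)
      U.mul_inv
    rw [hU] at this
    exact this
  have hpt : ∀ i t, v i t + ∑ l : Fin r, ∑ k : Fin m, A l i k t * (iccInt h)^[r - l] (v k) t =
      f i t := fun i t => by
    rw [← one_add_volterraCLM_apply, hv]
    rfl
  have hfun : ∀ i, ⇑(v i) = (f i).toFun + (-1 : ℂ) • ∑ l : Fin r, ∑ k : Fin m,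
      (A l i k).toFun * (iccInt h)^[r - l] (v k) := fun i => funext fun t => by
    simp only [Pi.add_apply, Pi.smul_apply, Finset.sum_apply, Pi.mul_apply, smul_eq_mul, ← hpt i t]
    ring
  -- The coefficients and `f` are regular up to order `n`, so the iterated integrals alone decide
  -- the order reached by `v`.
  have step : ∀ k ≤ n, (∀ (i : Fin m) (j : ℕ), 1 ≤ j → MemHolderSpace h k α ((iccInt h)^[j] (v i))) →
      ∀ i, MemHolderSpace h k α (v i) := by
    intro k hk H i
    rw [hfun]
    exact ((mem (f i)).of_le hα hk).add (MemHolderSpace.smul _ (memHolderSpace_sum fun l _ =>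
      memHolderSpace_sum fun k _ => ((mem (A l i k)).of_le hα hk).mul hα (H k _ (by omega))))
  have hmem : ∀ k ≤ n, ∀ i, MemHolderSpace h k α (v i) := by
    intro k
    induction k with
    | zero =>
      exact fun hk => step 0 hk fun i j hj =>
        memHolderSpace_zero_iccInt_iterate hα (v i).continuous hj
    | succ k ih =>
      exact fun hk => step (k + 1) hk fun i j hj =>
        ((ih (by omega) i).iccInt_iterate j).of_le hα (by omega)
  refine ⟨fun i => ofMem (v i) (hmem n le_rfl i), funext fun i => toFun_injective
    (funext fun t => ?_)⟩
  rw [odeCLM_intIterCLM_apply]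
  exact hpt i t

variable (h m r n) in
/-- The Cauchy data `(y^{(l)}(a))_{l < r}`. -/
noncomputable def cauchyData (hα : α ≤ 1) :
    (Fin m → HolderSpace h (n + r) α) →ₗ[ℂ] (Fin r → Fin m → ℂ) :=
  LinearMap.pi fun l => LinearMap.pi fun i =>
    ((evalCLM h n α ⟨a, left_mem_Icc.2 h.le⟩).comp
      ((derivCLM h hα (Nat.add_le_add_left l.2.le n)).comp
        (ContinuousLinearMap.proj i))).toLinearMap

theorem cauchyData_apply (hα : α ≤ 1) (y : Fin m → HolderSpace h (n + r) α) (l : Fin r)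
    (i : Fin m) : cauchyData h m r n hα y l i =
      iccDeriv h l (y i).toFun ⟨a, left_mem_Icc.2 h.le⟩ := rfl

theorem odeCLM_cauchyData_injective (hα : α ≤ 1)
    (A : Fin r → Matrix (Fin m) (Fin m) (HolderSpace h n α))
    {y : Fin m → HolderSpace h (n + r) α} (hy : odeCLM hα A y = 0)
    (hy0 : cauchyData h m r n hα y = 0) : y = 0 := by
  have e : y = fun k => intIterCLM h n α r (derivCLM h hα le_rfl (y k)) := funext fun k =>
    eq_intIterCLM hα (y k) fun l hl => congrFun (congrFun hy0 ⟨l, hl⟩) k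
  rw [e] at hy
  have := odeCLM_intIterCLM_injective hα A hy
  rw [e]
  exact funext fun k => (congrArg _ (congrFun this k)).trans (map_zero _)

theorem cauchyData_intIterCLM (hα : α ≤ 1) (u : Fin m → HolderSpace h n α) :
    cauchyData h m r n hα (fun k => intIterCLM h n α r (u k)) = 0 := by
  funext l i
  rw [cauchyData_apply, intIterCLM_toFun, iccDeriv_iccInt_iterate (mem _).continuous l.2.le]
  obtain ⟨k, hk⟩ := Nat.exists_eq_add_of_lt l.2
  rw [show r - l = k + 1 by omega, Function.iterate_succ_apply', iccInt_left]
  rfl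

/-- The Taylor polynomial with the prescribed derivatives at `a` is a preimage. -/
theorem cauchyData_surjective (hα : α ≤ 1) :
    Function.Surjective (cauchyData h m r n hα) := by
  intro d
  refine ⟨fun i => ∑ l : Fin r, d l i • monomial h (n + r) hα l, ?_⟩
  funext j i
  change evalCLM h n α _ (derivCLM h hα (Nat.add_le_add_left j.2.le n)
    (∑ l : Fin r, d l i • monomial h (n + r) hα l)) = _
  simp only [map_sum, map_smul]
  simp only [evalCLM_apply, derivCLM_toFun, monomial_toFun,
    iccDeriv_monomial_left, smul_eq_mul]
  simp [Fin.val_inj]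

/-- The Cauchy problem is uniquely solvable. -/
noncomputable def cauchyEquiv (hα : α ≤ 1)
    (A : Fin r → Matrix (Fin m) (Fin m) (HolderSpace h n α)) :
    (Fin m → HolderSpace h (n + r) α) ≃ₗ[ℂ] (Fin m → HolderSpace h n α) × (Fin r → Fin m → ℂ) :=
  LinearEquiv.ofBijective ((odeCLM hα A).toLinearMap.prod (cauchyData h m r n hα)) <| by
    constructor
    · rw [injective_iff_map_eq_zero]
      intro y hy
      exact odeCLM_cauchyData_injective hα A (congrArg Prod.fst hy) (congrArg Prod.snd hy)
    · rintro ⟨f, d⟩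
      obtain ⟨p, hp⟩ := cauchyData_surjective (h := h) (m := m) (r := r) (n := n) hα d
      obtain ⟨u, hu⟩ := odeCLM_intIterCLM_surjective hα A (f - odeCLM hα A p)
      refine ⟨p + fun k => intIterCLM h n α r (u k), Prod.ext ?_ ?_⟩
      · change odeCLM hα A (p + _) = f
        rw [map_add, hu, add_sub_cancel]
      · change cauchyData h m r n hα (p + _) = d
        rw [map_add, hp, cauchyData_intIterCLM, add_zero]

theorem cauchyEquiv_fst (hα : α ≤ 1) (A : Fin r → Matrix (Fin m) (Fin m) (HolderSpace h n α))
    (y : Fin m → HolderSpace h (n + r) α) : (cauchyEquiv hα A y).1 = odeCLM hα A y := rfl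

/-- Fredholm alternative for the boundary-value problem. -/
theorem exists_bvp_solution_of_injective (hα : α ≤ 1)
    (A : Fin r → Matrix (Fin m) (Fin m) (HolderSpace h n α))
    (B : (Fin m → HolderSpace h (n + r) α) →L[ℂ] EuclideanSpace ℂ (Fin (r * m)))
    (H : ∀ y, odeCLM hα A y = 0 → B y = 0 → y = 0)
    (f : Fin m → HolderSpace h n α) (c : EuclideanSpace ℂ (Fin (r * m))) :
    ∃ y, odeCLM hα A y = f ∧ B y = c := by
  let S := cauchyEquiv hα A
  have hS : ∀ p, odeCLM hα A (S.symm p) = p.1 := fun p => by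
    rw [← cauchyEquiv_fst]
    exact congrArg Prod.fst (S.apply_symm_apply p)
  -- `V` is the boundary operator on the kernel of `L`, parametrised by Cauchy data. Source and
  -- target both have dimension `rm`, so injectivity gives surjectivity, and a kernel element can
  -- correct the boundary value of any particular solution.
  let V : (Fin r → Fin m → ℂ) →ₗ[ℂ] EuclideanSpace ℂ (Fin (r * m)) :=
    B.toLinearMap ∘ₗ S.symm.toLinearMap ∘ₗ LinearMap.inr ℂ _ _
  have hV : Function.Injective V := by
    rw [injective_iff_map_eq_zero]
    intro d hd
    have := H (S.symm (0, d)) (hS _) hd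
    rw [LinearEquiv.map_eq_zero_iff] at this
    exact congrArg Prod.snd this
  have hdim : Module.finrank ℂ (Fin r → Fin m → ℂ) =
      Module.finrank ℂ (EuclideanSpace ℂ (Fin (r * m))) := by
    simp [Module.finrank_pi_fintype]
  obtain ⟨d, hd⟩ := (LinearMap.injective_iff_surjective_of_finrank_eq_finrank hdim).1 hV
    (c - B (S.symm (f, 0)))
  refine ⟨S.symm (f, 0) + S.symm (0, d), ?_, ?_⟩
  · rw [map_add, hS, hS, add_zero]
  · rw [map_add]
    have : B (S.symm (0, d)) = c - B (S.symm (f, 0)) := hd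
    rw [this, add_sub_cancel]

/-! ### Coefficients against operators: two-sided estimates. -/

/-- The sum of the norms of all entries of all coefficients. -/
noncomputable def coeffNorm (A : Fin r → Matrix (Fin m) (Fin m) (HolderSpace h n α)) : ℝ :=
  ∑ l, ∑ i, ∑ k, ‖A l i k‖

theorem norm_le_coeffNorm (A : Fin r → Matrix (Fin m) (Fin m) (HolderSpace h n α)) (l i k) :
    ‖A l i k‖ ≤ coeffNorm A := by
  refine le_trans ?_ (Finset.single_le_sum (f := fun l => ∑ i, ∑ k, ‖A l i k‖)
    (fun _ _ => by positivity) (Finset.mem_univ l))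
  refine le_trans ?_ (Finset.single_le_sum (f := fun i => ∑ k, ‖A l i k‖)
    (fun _ _ => by positivity) (Finset.mem_univ i))
  exact Finset.single_le_sum (f := fun k => ‖A l i k‖)
    (fun _ _ => by positivity) (Finset.mem_univ k)

theorem odeCLM_sub_apply (hα : α ≤ 1)
    (A A' : Fin r → Matrix (Fin m) (Fin m) (HolderSpace h n α))
    (y : Fin m → HolderSpace h (n + r) α) (i : Fin m) :
    (odeCLM hα A - odeCLM hα A') y i = ∑ l : Fin r, ∑ k, mulCLM h n hα ((A - A') l i k)
      (derivCLM h hα (Nat.add_le_add_left l.2.le n) (y k)) := by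
  have e : ∀ A : Fin r → Matrix (Fin m) (Fin m) (HolderSpace h n α), odeCLM hα A y i =
      derivCLM h hα (le_refl (n + r)) (y i) + ∑ l : Fin r, ∑ k, mulCLM h n hα (A l i k)
      (derivCLM h hα (Nat.add_le_add_left l.2.le n) (y k)) := fun A => by
    simp [odeCLM]
  rw [sub_apply, Pi.sub_apply, e, e, add_sub_add_left_eq_sub]
  simp only [← Finset.sum_sub_distrib]
  refine Finset.sum_congr rfl fun l _ => Finset.sum_congr rfl fun k _ => ?_
  simp [Pi.sub_apply, Matrix.sub_apply]

theorem exists_norm_odeCLM_sub_le (hα : α ≤ 1) :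
    ∃ C : ℝ, 0 ≤ C ∧ ∀ A A' : Fin r → Matrix (Fin m) (Fin m) (HolderSpace h n α),
      ‖odeCLM hα A - odeCLM hα A'‖ ≤ C * coeffNorm (A - A') := by
  let D : Fin r → HolderSpace h (n + r) α →L[ℂ] HolderSpace h n α :=
    fun l => derivCLM h hα (Nat.add_le_add_left l.2.le n)
  refine ⟨∑ l : Fin r, ∑ _k : Fin m, ‖mulCLM h n hα‖ * ‖D l‖, by positivity, fun A A' => ?_⟩
  have hN : 0 ≤ coeffNorm (A - A') := by unfold coeffNorm; positivity
  refine ContinuousLinearMap.opNorm_le_bound _ (by positivity) fun y => ?_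
  refine (pi_norm_le_iff_of_nonneg (by positivity)).2 fun i => ?_
  rw [odeCLM_sub_apply, Finset.sum_mul, Finset.sum_mul]
  refine (norm_sum_le _ _).trans (Finset.sum_le_sum fun l _ => ?_)
  rw [Finset.sum_mul, Finset.sum_mul]
  refine (norm_sum_le _ _).trans (Finset.sum_le_sum fun k _ => ?_)
  refine ((mulCLM h n hα).le_opNorm₂ _ _).trans ?_
  calc _ ≤ ‖mulCLM h n hα‖ * coeffNorm (A - A') * (‖D l‖ * ‖y‖) := by
        gcongr
        · exact norm_le_coeffNorm _ l i k
        · exact ((D l).le_opNorm _).trans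
            (mul_le_mul_of_nonneg_left (norm_le_pi_norm y k) (norm_nonneg _))
    _ = _ := by ring

/-- The monomial vector functions, which recover the coefficients of the operator. -/
noncomputable def monomialVec (hα : α ≤ 1) (p : Fin r × Fin m) :
    Fin m → HolderSpace h (n + r) α :=
  Pi.single p.2 (monomial h (n + r) hα p.1)

/-- The leading terms `y^{(r)}` cancel in the difference. On the monomial of degree `l` the
derivatives of order above `l` vanish and the one of order `l` is `1`, so the system for the
coefficients is triangular with unit diagonal. -/
theorem odeCLM_sub_monomialVec (hα : α ≤ 1)
    (A A' : Fin r → Matrix (Fin m) (Fin m) (HolderSpace h n α)) (l : Fin r) (i k : Fin m) :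
    (odeCLM hα A - odeCLM hα A') (monomialVec hα (l, k)) i =
      (A - A') l i k + ∑ j ∈ Finset.univ.filter (· < l), mulCLM h n hα ((A - A') j i k)
        (derivCLM h hα (Nat.add_le_add_left j.2.le n) (monomial h (n + r) hα l)) := by
  rw [odeCLM_sub_apply]
  have e1 : ∀ j : Fin r, ∑ k', mulCLM h n hα ((A - A') j i k')
      (derivCLM h hα (Nat.add_le_add_left j.2.le n) (monomialVec hα (l, k) k')) =
      mulCLM h n hα ((A - A') j i k)
        (derivCLM h hα (Nat.add_le_add_left j.2.le n) (monomial h (n + r) hα l)) := by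
    intro j
    rw [Finset.sum_eq_single k]
    · simp [monomialVec]
    · intro k' _ hk'
      simp [monomialVec, Pi.single_eq_of_ne hk']
    · simp
  simp only [e1]
  rw [← Finset.sum_filter_add_sum_filter_not Finset.univ (· < l), add_comm]
  congr 1
  rw [Finset.sum_eq_single l]
  · refine toFun_injective ?_
    simp [iccDeriv_monomial_self]
  · intro j hj hjl
    have hlt : l < j := lt_of_le_of_ne (not_lt.1 (Finset.mem_filter.1 hj).2) (Ne.symm hjl)
    refine toFun_injective ?_
    simp [iccDeriv_monomial_of_lt h hlt]
  · simp

theorem exists_coeffNorm_sub_le (hα : α ≤ 1) :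
    ∃ C : ℝ, 0 ≤ C ∧ ∀ A A' : Fin r → Matrix (Fin m) (Fin m) (HolderSpace h n α),
      coeffNorm (A - A') ≤
        C * ∑ p : Fin r × Fin m, ‖(odeCLM hα A - odeCLM hα A') (monomialVec hα p)‖ := by
  have key : ∀ l : Fin r, ∃ C : ℝ, 0 ≤ C ∧
      ∀ (A A' : Fin r → Matrix (Fin m) (Fin m) (HolderSpace h n α)) (i k : Fin m),
        ‖(A - A') l i k‖ ≤
          C * ∑ p : Fin r × Fin m, ‖(odeCLM hα A - odeCLM hα A') (monomialVec hα p)‖ := by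
    intro l
    induction l using WellFoundedLT.induction with
    | ind l ih =>
    -- Forward substitution: the coefficients with index below `l` are already controlled, with
    -- constants `C j` independent of `A` and `A'`.
    choose! C hC H using ih
    let D : Fin r → HolderSpace h n α := fun j =>
      derivCLM h hα (Nat.add_le_add_left j.2.le n) (monomial h (n + r) hα l)
    refine ⟨1 + ∑ j ∈ Finset.univ.filter (· < l), ‖mulCLM h n hα‖ * C j * ‖D j‖, ?_, ?_⟩
    · refine add_nonneg zero_le_one (Finset.sum_nonneg fun j hj => ?_)
      have := hC j (Finset.mem_filter.1 hj).2
      positivity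
    · intro A A' i k
      set S := ∑ p : Fin r × Fin m, ‖(odeCLM hα A - odeCLM hα A') (monomialVec hα p)‖ with hS
      have e := odeCLM_sub_monomialVec hα A A' l i k
      rw [← sub_eq_iff_eq_add] at e
      rw [← e, add_mul, one_mul, Finset.sum_mul]
      refine (norm_sub_le _ _).trans (add_le_add ?_ ?_)
      · refine (norm_le_pi_norm _ i).trans ?_
        exact Finset.single_le_sum
          (f := fun p => ‖(odeCLM hα A - odeCLM hα A') (monomialVec hα p)‖)
          (fun _ _ => norm_nonneg _) (Finset.mem_univ (l, k))
      · refine (norm_sum_le _ _).trans (Finset.sum_le_sum fun j hj => ?_)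
        refine ((mulCLM h n hα).le_opNorm₂ _ _).trans ?_
        calc _ ≤ ‖mulCLM h n hα‖ * (C j * S) * ‖D j‖ := by
              gcongr
              exact H j (Finset.mem_filter.1 hj).2 A A' i k
          _ = _ := by ring
  choose C hC H using key
  refine ⟨∑ l, ∑ _i : Fin m, ∑ _k : Fin m, C l, Finset.sum_nonneg fun l _ =>
    Finset.sum_nonneg fun _ _ => Finset.sum_nonneg fun _ _ => hC l, fun A A' => ?_⟩
  simp only [coeffNorm, Finset.sum_mul]
  exact Finset.sum_le_sum fun l _ => Finset.sum_le_sum fun i _ => Finset.sum_le_sum fun k _ =>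
    H l A A' i k

end Operator

/-! ### Perturbation of invertible pairs of operators. -/

section FunctionalAnalysis

variable {E F G : Type*} [NormedAddCommGroup E] [NormedSpace ℂ E] [NormedAddCommGroup F]
  [NormedSpace ℂ F] [NormedAddCommGroup G] [NormedSpace ℂ G]

/-- Banach–Steinhaus along a countably generated filter. -/
theorem exists_eventually_norm_le_of_tendsto [CompleteSpace E] {X : Type*} {l : Filter X}
    [l.IsCountablyGenerated] {B : X → E →L[ℂ] G} {B₀ : E →L[ℂ] G}
    (hB : ∀ y, Tendsto (fun ε => B ε y) l (𝓝 (B₀ y))) : ∃ M, ∀ᶠ ε in l, ‖B ε‖ ≤ M := by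
  by_contra! H
  obtain ⟨s, hs⟩ := l.exists_antitone_basis
  -- Convergence along a filter does not bound the whole family, so the uniform boundedness
  -- principle is applied to a sequence `e N` tending to the filter along which the norms would
  -- exceed every `N`.
  have H' : ∀ N : ℕ, ∃ ε ∈ s N, (N : ℝ) < ‖B ε‖ := fun N => by
    have hsN : ∀ᶠ ε in l, ε ∈ s N := hs.1.mem_of_mem trivial
    obtain ⟨ε, h1, h2⟩ := ((H N).and_eventually hsN).exists
    exact ⟨ε, h2, h1⟩
  choose e he hN using H'
  have hl : Tendsto e atTop l := hs.tendsto he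
  obtain ⟨C, hC⟩ := banach_steinhaus (g := fun N => B (e N)) fun y => by
    obtain ⟨C, hC⟩ := ((hB y).comp hl).norm.bddAbove_range
    exact ⟨C, fun N => hC ⟨N, rfl⟩⟩
  obtain ⟨N, hCN⟩ := exists_nat_gt C
  exact absurd (hC N) (not_le.2 (hCN.trans (hN N)))

theorem tendsto_clm_of_forall_tendsto [FiniteDimensional ℂ G] {X : Type*} {l : Filter X}
    {W : X → G →L[ℂ] E} {W₀ : G →L[ℂ] E}
    (hW : ∀ y, Tendsto (fun ε => W ε y) l (𝓝 (W₀ y))) : Tendsto W l (𝓝 W₀) := by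
  let v := Module.finBasis ℂ G
  obtain ⟨C, hC, H⟩ := v.exists_opNorm_le (F := E)
  rw [tendsto_iff_norm_sub_tendsto_zero]
  have hs : Tendsto (fun ε => C * ∑ i, ‖(W ε - W₀) (v i)‖) l (𝓝 0) := by
    have : Tendsto (fun ε => ∑ i, ‖(W ε - W₀) (v i)‖) l (𝓝 (∑ _i, 0)) :=
      tendsto_finsetSum _ fun i _ => tendsto_iff_norm_sub_tendsto_zero.1 (hW (v i))
    simpa using this.const_mul C
  exact squeeze_zero (fun _ => norm_nonneg _) (fun ε => H (by positivity) fun i =>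
    Finset.single_le_sum (f := fun i => ‖(W ε - W₀) (v i)‖) (fun _ _ => norm_nonneg _)
      (Finset.mem_univ i)) hs

/-- Stability of the a priori estimate under norm convergence of `L` and strong convergence of the
operator `B` of finite rank. -/
theorem exists_eventually_norm_le_add [CompleteSpace E] [CompleteSpace F] [FiniteDimensional ℂ G]
    {X : Type*} {l : Filter X} [l.IsCountablyGenerated] {L : X → E →L[ℂ] F} {L₀ : E →L[ℂ] F}
    {B : X → E →L[ℂ] G} {B₀ : E →L[ℂ] G} (hbij : Function.Bijective (L₀.prod B₀))
    (hL : Tendsto L l (𝓝 L₀)) (hB : ∀ y, Tendsto (fun ε => B ε y) l (𝓝 (B₀ y))) :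
    ∃ C : ℝ, ∀ᶠ ε in l, ∀ y, ‖y‖ ≤ C * (‖L ε y‖ + ‖B ε y‖) := by
  have : CompleteSpace G := FiniteDimensional.complete ℂ G
  let S := ContinuousLinearEquiv.ofBijective (L₀.prod B₀)
    (LinearMap.ker_eq_bot.2 hbij.1) (LinearMap.range_eq_top.2 hbij.2)
  -- `U` and `V` are the two components of the inverse of `(L₀, B₀)`, so every `y` splits as `U (L₀
  -- y) + V (B₀ y)`.
  let U : F →L[ℂ] E := S.symm.toContinuousLinearMap.comp (ContinuousLinearMap.inl ℂ F G)
  let V : G →L[ℂ] E := S.symm.toContinuousLinearMap.comp (ContinuousLinearMap.inr ℂ F G)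
  have hUV : ∀ y, U (L₀ y) + V (B₀ y) = y := fun y => by
    change S.symm (L₀ y, 0) + S.symm (0, B₀ y) = y
    rw [← map_add, Prod.mk_add_mk, add_zero, zero_add]
    exact S.symm_apply_apply y
  have hBV : B₀.comp V = ContinuousLinearMap.id ℂ G := ContinuousLinearMap.ext fun d =>
    congrArg Prod.snd (S.apply_symm_apply (0, d))
  obtain ⟨M, hM⟩ := exists_eventually_norm_le_of_tendsto hB
  have hV : Tendsto (fun ε => ‖(B ε).comp V - B₀.comp V‖) l (𝓝 0) :=
    tendsto_iff_norm_sub_tendsto_zero.1 (tendsto_clm_of_forall_tendsto fun d => hB (V d))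
  have hL' : Tendsto (fun ε => ‖L ε - L₀‖) l (𝓝 0) := tendsto_iff_norm_sub_tendsto_zero.1 hL
  set M' := max M 0
  have hM' : 0 ≤ M' := le_max_right _ _
  -- `‖y‖ ≤ K ‖L₀ y‖ + 2 ‖V‖ ‖B(ε) y‖` for `ε` close to the limit
  set K := ‖U‖ + 2 * ‖V‖ * (M' * ‖U‖) with hK
  have hK0 : 0 ≤ K := by positivity
  refine ⟨2 * (K + 2 * ‖V‖), ?_⟩
  have hδ : ∀ᶠ ε in l, K * ‖L ε - L₀‖ < 1 / 2 := by
    have := hL'.const_mul K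
    rw [mul_zero] at this
    exact this.eventually_lt_const (by norm_num)
  filter_upwards [hM, hV.eventually_lt_const (show (0 : ℝ) < 1 / 2 by norm_num), hδ]
    with ε h1 h2 h3 y
  set f := L₀ y with hf
  set c := B₀ y with hc
  have hy : ‖y‖ ≤ ‖U‖ * ‖f‖ + ‖V‖ * ‖c‖ := by
    calc ‖y‖ = ‖U f + V c‖ := by rw [hUV]
      _ ≤ _ := (norm_add_le _ _).trans (add_le_add (U.le_opNorm _) (V.le_opNorm _))
  have hcb : ‖c‖ ≤ ‖B ε y‖ + M' * (‖U‖ * ‖f‖) + 1 / 2 * ‖c‖ := by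
    -- Since `B₀ V = 1`, the operator `B(ε) V` is close to the identity in norm, and the last term
    -- can be absorbed into `‖c‖`.
    have e : c = B ε y - B ε (U f) - ((B ε).comp V - B₀.comp V) c := by
      have e' : B ε y = B ε (U f) + B ε (V c) := by rw [← map_add, hUV]
      rw [hBV, e']
      simp
    calc ‖c‖ ≤ ‖B ε y‖ + ‖B ε (U f)‖ + ‖((B ε).comp V - B₀.comp V) c‖ := by
          nth_rw 1 [e]
          exact (norm_sub_le _ _).trans (add_le_add_left (norm_sub_le _ _) _)
      _ ≤ _ := by
          refine add_le_add (add_le_add le_rfl ?_) ?_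
          · exact ((B ε).le_of_opNorm_le (h1.trans (le_max_left _ _)) _).trans
              (mul_le_mul_of_nonneg_left (U.le_opNorm _) hM')
          · exact ContinuousLinearMap.le_of_opNorm_le _ h2.le _
  have hfb : ‖f‖ ≤ ‖L ε y‖ + ‖L ε - L₀‖ * ‖y‖ := by
    have e : f = L ε y - (L ε - L₀) y := by simp [hf]
    calc ‖f‖ ≤ ‖L ε y‖ + ‖(L ε - L₀) y‖ := by
          nth_rw 1 [e]
          exact norm_sub_le _ _
      _ ≤ _ := add_le_add le_rfl (ContinuousLinearMap.le_opNorm _ _)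
  have s1 : ‖y‖ ≤ K * ‖f‖ + 2 * ‖V‖ * ‖B ε y‖ := by
    have : ‖V‖ * ‖c‖ ≤ ‖V‖ * (2 * (‖B ε y‖ + M' * (‖U‖ * ‖f‖))) :=
      mul_le_mul_of_nonneg_left (by linarith) (norm_nonneg _)
    rw [hK]
    linarith
  have s2 : K * ‖f‖ ≤ K * ‖L ε y‖ + 1 / 2 * ‖y‖ := by
    calc K * ‖f‖ ≤ K * (‖L ε y‖ + ‖L ε - L₀‖ * ‖y‖) := mul_le_mul_of_nonneg_left hfb hK0
      _ = K * ‖L ε y‖ + K * ‖L ε - L₀‖ * ‖y‖ := by ring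
      _ ≤ _ := by gcongr
  have s3 : 0 ≤ K * ‖B ε y‖ := by positivity
  have s4 : 0 ≤ ‖V‖ * ‖L ε y‖ := by positivity
  linarith

/-- Once `s < 1/2`, half of `N` is absorbed on the left and `N ≤ 2 τ` remains. No prior bound on `N`
is needed. -/
theorem tendsto_zero_of_le_mul_add {X : Type*} {l : Filter X} {N s τ : X → ℝ}
    (hN : ∀ ε, 0 ≤ N ε) (hs : Tendsto s l (𝓝 0)) (hτ : Tendsto τ l (𝓝 0))
    (H : ∀ᶠ ε in l, N ε ≤ s ε * N ε + τ ε) : Tendsto N l (𝓝 0) := by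
  have h2 : Tendsto (fun ε => 2 * τ ε) l (𝓝 0) := by simpa using hτ.const_mul 2
  refine squeeze_zero' (Eventually.of_forall hN) ?_ h2
  filter_upwards [H, hs.eventually_lt_const (show (0 : ℝ) < 1 / 2 by norm_num)] with ε h1 h3
  nlinarith [hN ε]

variable {l : Filter ℝ} {L : ℝ → E →L[ℂ] F} {B : ℝ → E →L[ℂ] G} {R : ℝ → F × G →ₗ[ℂ] E}

/-- Put `z = q - R(ε)(L(0) q, B(0) q)`, which tends to `0`. Since `L(ε) R(ε)` returns the first
datum, `(L(ε) - L(0)) q = (L(ε) - L(0)) z + L(0) z`. The first term is at most `C₂ N(ε) ‖z‖` and is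
absorbed; the second tends to `0`. -/
theorem tendsto_zero_of_continuous_inverse (hR₀ : ∀ y, R 0 (L 0 y, B 0 y) = y)
    (hR : ∀ᶠ ε in l, ∀ p, L ε (R ε p) = p.1)
    (hcont : ∀ p : ℝ → F × G, Tendsto p l (𝓝 (p 0)) →
      Tendsto (fun ε => R ε (p ε)) l (𝓝 (R 0 (p 0))))
    {ι : Type*} [Fintype ι] (q : ι → E) {N : ℝ → ℝ} (hN : ∀ ε, 0 ≤ N ε) {C₁ C₂ : ℝ}
    (hC₁ : 0 ≤ C₁) (h1 : ∀ ε, N ε ≤ C₁ * ∑ i, ‖(L ε - L 0) (q i)‖)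
    (h2 : ∀ ε, ‖L ε - L 0‖ ≤ C₂ * N ε) : Tendsto N l (𝓝 0) := by
  have hz : ∀ i, Tendsto (fun ε => q i - R ε (L 0 (q i), B 0 (q i))) l (𝓝 0) := fun i => by
    have := hcont (fun _ => (L 0 (q i), B 0 (q i))) tendsto_const_nhds
    rw [hR₀] at this
    simpa using this.const_sub (q i)
  have hs : Tendsto (fun ε => C₁ * C₂ * ∑ i, ‖q i - R ε (L 0 (q i), B 0 (q i))‖) l (𝓝 0) := by
    have := (tendsto_finsetSum Finset.univ fun i _ => (hz i).norm).const_mul (C₁ * C₂)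
    simpa using this
  have hτ : Tendsto (fun ε => C₁ * ∑ i, ‖L 0 (q i - R ε (L 0 (q i), B 0 (q i)))‖) l (𝓝 0) := by
    have := (tendsto_finsetSum Finset.univ fun i _ =>
      (((L 0).continuous.tendsto 0).comp (hz i)).norm).const_mul C₁
    simpa using this
  refine tendsto_zero_of_le_mul_add hN hs hτ ?_
  filter_upwards [hR] with ε hε
  have key : ∀ i, ‖(L ε - L 0) (q i)‖ ≤ C₂ * N ε * ‖q i - R ε (L 0 (q i), B 0 (q i))‖ +
      ‖L 0 (q i - R ε (L 0 (q i), B 0 (q i)))‖ := fun i => by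
    have e : (L ε - L 0) (q i) = (L ε - L 0) (q i - R ε (L 0 (q i), B 0 (q i))) +
        L 0 (q i - R ε (L 0 (q i), B 0 (q i))) := by
      simp [map_sub, hε]
    rw [e]
    exact (norm_add_le _ _).trans
      (add_le_add (ContinuousLinearMap.le_of_opNorm_le _ (h2 ε) _) le_rfl)
  calc N ε ≤ C₁ * ∑ i, ‖(L ε - L 0) (q i)‖ := h1 ε
    _ ≤ C₁ * ∑ i, (C₂ * N ε * ‖q i - R ε (L 0 (q i), B 0 (q i))‖ +
      ‖L 0 (q i - R ε (L 0 (q i), B 0 (q i)))‖) :=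
        mul_le_mul_of_nonneg_left (Finset.sum_le_sum fun i _ => key i) hC₁
    _ = _ := by
        rw [Finset.sum_add_distrib, ← Finset.mul_sum]
        ring

/-- For `w(ε) = y - R(ε)(L(0) y, B(0) y) → 0` the difference `B(ε) y - B(0) y` is `B(ε) w(ε)`. Its
image under `W(ε) = R(ε)(0, ·)` is `w(ε) - R(ε)(L(ε) w(ε), 0)`, which tends to `0`. As `W(ε) → W(0)`
in norm and `B(0) W(0) = 1`, the vector itself tends to `0`, again by absorption. -/
theorem tendsto_apply_of_continuous_inverse [FiniteDimensional ℂ G]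
    (hR₀ : ∀ y, R 0 (L 0 y, B 0 y) = y)
    (hR₀' : ∀ p, B 0 (R 0 p) = p.2)
    (hR : ∀ᶠ ε in l, ∀ y, R ε (L ε y, B ε y) = y) (hR' : ∀ᶠ ε in l, ∀ p, B ε (R ε p) = p.2)
    (hcont : ∀ p : ℝ → F × G, Tendsto p l (𝓝 (p 0)) →
      Tendsto (fun ε => R ε (p ε)) l (𝓝 (R 0 (p 0))))
    (hL : Tendsto L l (𝓝 (L 0))) (y : E) : Tendsto (fun ε => B ε y) l (𝓝 (B 0 y)) := by
  set w : ℝ → E := fun ε => y - R ε (L 0 y, B 0 y) with hw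
  have hw0 : w 0 = 0 := by simp [hw, hR₀]
  have hwt : Tendsto w l (𝓝 0) := by
    have := hcont (fun _ => (L 0 y, B 0 y)) tendsto_const_nhds
    rw [hR₀] at this
    simpa [hw] using this.const_sub y
  have hLw : Tendsto (fun ε => L ε (w ε)) l (𝓝 0) := by
    simpa [Function.comp_def] using
      (isBoundedBilinearMap_apply.continuous.tendsto (L 0, (0 : E))).comp (hL.prodMk_nhds hwt)
  -- The right-hand side `(L(ε) w(ε), 0)` varies with `ε`, so constant data would not suffice here;
  -- its value at `ε = 0` is `0` because `w(0) = 0`.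
  have hRL : Tendsto (fun ε => R ε (L ε (w ε), 0)) l (𝓝 0) := by
    have := hcont (fun ε => (L ε (w ε), 0)) (by
      simp only [hw0, map_zero]
      exact hLw.prodMk_nhds tendsto_const_nhds)
    simp only [hw0, map_zero] at this
    rwa [show ((0 : F), (0 : G)) = 0 from rfl, map_zero] at this
  let W : ℝ → G →L[ℂ] E := fun ε => (R ε ∘ₗ LinearMap.inr ℂ F G).toContinuousLinearMap
  have hW : Tendsto W l (𝓝 (W 0)) := tendsto_clm_of_forall_tendsto fun d =>
    hcont (fun _ => (0, d)) tendsto_const_nhds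
  have hinv : ∀ d, B 0 (W 0 d) = d := fun d => hR₀' (0, d)
  have hd : Tendsto (fun ε => ‖B ε (w ε)‖) l (𝓝 0) := by
    have hs : Tendsto (fun ε => ‖B 0‖ * ‖W ε - W 0‖) l (𝓝 0) := by
      simpa using (tendsto_iff_norm_sub_tendsto_zero.1 hW).const_mul ‖B 0‖
    have hτ : Tendsto (fun ε => ‖B 0‖ * ‖w ε - R ε (L ε (w ε), 0)‖) l (𝓝 0) := by
      simpa using ((hwt.sub hRL).norm).const_mul ‖B 0‖
    refine tendsto_zero_of_le_mul_add (fun _ => norm_nonneg _) hs hτ ?_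
    filter_upwards [hR] with ε hε
    have e1 : W ε (B ε (w ε)) = w ε - R ε (L ε (w ε), 0) := by
      change R ε (0, B ε (w ε)) = _
      nth_rw 2 [← hε (w ε)]
      rw [← map_sub, Prod.mk_sub_mk, sub_self, sub_zero]
    have e2 : B ε (w ε) = B 0 (W ε (B ε (w ε)) - (W ε - W 0) (B ε (w ε))) := by
      simp [hinv]
    calc ‖B ε (w ε)‖ ≤ ‖B 0‖ * (‖w ε - R ε (L ε (w ε), 0)‖ + ‖W ε - W 0‖ * ‖B ε (w ε)‖) := by
          nth_rw 1 [e2]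
          refine ((B 0).le_opNorm _).trans (mul_le_mul_of_nonneg_left ?_ (norm_nonneg _))
          rw [e1]
          exact (norm_sub_le _ _).trans (add_le_add le_rfl (ContinuousLinearMap.le_opNorm _ _))
      _ = _ := by ring
  rw [tendsto_iff_norm_sub_tendsto_zero]
  refine hd.congr' ?_
  filter_upwards [hR'] with ε hε
  simp [hw, map_sub, hε]

end FunctionalAnalysis

/-! ### The two implications. -/

section Main

variable {a b : ℝ} {h : a < b} {m r n : ℕ} {α : ℝ}

theorem tendsto_coeffNorm_iff {X : Type*} {l : Filter X}
    {A : X → Fin r → Matrix (Fin m) (Fin m) (HolderSpace h n α)}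
    {A₀ : Fin r → Matrix (Fin m) (Fin m) (HolderSpace h n α)} :
    Tendsto (fun ε => coeffNorm (A ε - A₀)) l (𝓝 0) ↔
      ∀ j, Tendsto (fun ε => A ε j) l (𝓝 (A₀ j)) := by
  constructor
  · intro H j
    refine tendsto_pi_nhds.2 fun i => tendsto_pi_nhds.2 fun k => ?_
    exact tendsto_iff_norm_sub_tendsto_zero.2
      (squeeze_zero (fun _ => norm_nonneg _) (fun ε => norm_le_coeffNorm (A ε - A₀) j i k) H)
  · intro H
    have : Tendsto (fun ε => coeffNorm (A ε - A₀)) l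
        (𝓝 (∑ _j : Fin r, ∑ _i : Fin m, ∑ _k : Fin m, 0)) :=
      tendsto_finsetSum _ fun j _ => tendsto_finsetSum _ fun i _ => tendsto_finsetSum _ fun k _ =>
        tendsto_iff_norm_sub_tendsto_zero.1
          (tendsto_pi_nhds.1 (tendsto_pi_nhds.1 (H j) i) k)
    simpa using this

theorem tendsto_odeCLM (hα : α ≤ 1) {X : Type*} {l : Filter X}
    {A : X → Fin r → Matrix (Fin m) (Fin m) (HolderSpace h n α)}
    {A₀ : Fin r → Matrix (Fin m) (Fin m) (HolderSpace h n α)}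
    (H : ∀ j, Tendsto (fun ε => A ε j) l (𝓝 (A₀ j))) :
    Tendsto (fun ε => odeCLM hα (A ε)) l (𝓝 (odeCLM hα A₀)) := by
  obtain ⟨C, -, hC⟩ := exists_norm_odeCLM_sub_le (h := h) (m := m) (r := r) (n := n) hα
  rw [tendsto_iff_norm_sub_tendsto_zero]
  exact squeeze_zero (fun _ => norm_nonneg _) (fun ε => hC _ _)
    (by simpa using (tendsto_coeffNorm_iff.2 H).const_mul C)

variable {ε₀ : ℝ} {A : ℝ → Fin r → Matrix (Fin m) (Fin m) (HolderSpace h n α)}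
  {B : ℝ → (Fin m → HolderSpace h (n + r) α) →L[ℂ] EuclideanSpace ℂ (Fin (r * m))}

theorem dependsContinuouslyAtZero_of_tendsto (hα : α ≤ 1) (hε₀ : 0 < ε₀)
    (h0 : ∀ y : Fin m → HolderSpace h (n + r) α, IsBVPSolution (A 0) (B 0) 0 0 y → y = 0)
    (hA : ∀ l : Fin r, Tendsto (fun ε => A ε l) (𝓝[>] 0) (𝓝 (A 0 l)))
    (hB : ∀ y : Fin m → HolderSpace h (n + r) α,
      Tendsto (fun ε => B ε y) (𝓝[>] 0) (𝓝 (B 0 y))) :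
    DependsContinuouslyAtZero ε₀ A B := by
  have : CompleteSpace (HolderSpace h n α) := HolderSpace.completeSpace hα
  have : CompleteSpace (HolderSpace h (n + r) α) := HolderSpace.completeSpace hα
  have uniq : ∀ {ε}, (∀ y, odeCLM hα (A ε) y = 0 → B ε y = 0 → y = 0) →
      ∀ f c, ∃! y, IsBVPSolution (A ε) (B ε) f c y := by
    intro ε hε f c
    obtain ⟨y, hy⟩ := exists_bvp_solution_of_injective hα (A ε) (B ε) hε f c
    refine ⟨y, (isBVPSolution_iff hα).2 hy, fun z hz => ?_⟩
    obtain ⟨hz1, hz2⟩ := (isBVPSolution_iff hα).1 hz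
    exact sub_eq_zero.1 (hε _ (by rw [map_sub, hz1, hy.1, sub_self])
      (by rw [map_sub, hz2, hy.2, sub_self]))
  have inj0 : ∀ y, odeCLM hα (A 0) y = 0 → B 0 y = 0 → y = 0 :=
    fun y h1 h2 => h0 y ((isBVPSolution_iff hα).2 ⟨h1, h2⟩)
  have hbij : Function.Bijective ((odeCLM hα (A 0)).prod (B 0)) := by
    constructor
    · rw [injective_iff_map_eq_zero]
      exact fun y hy => inj0 y (congrArg Prod.fst hy) (congrArg Prod.snd hy)
    · rintro ⟨f, c⟩
      obtain ⟨y, h1, h2⟩ := exists_bvp_solution_of_injective hα (A 0) (B 0) inj0 f c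
      exact ⟨y, Prod.ext h1 h2⟩
  obtain ⟨C, hC⟩ := exists_eventually_norm_le_add hbij (tendsto_odeCLM hα hA) hB
  obtain ⟨δ, hδ, hδC⟩ := mem_nhdsGT_iff_exists_Ioo_subset.1 hC
  have hδ0 : 0 < δ := hδ
  -- The estimate holds on `(0, δ)` only, so `ε = 0` is treated separately by the hypothesis on the
  -- homogeneous problem; `ε₀ / 2` ensures `ε₁ < ε₀`.
  refine ⟨min δ (ε₀ / 2), lt_min hδ0 (half_pos hε₀),
    (min_le_right _ _).trans_lt (half_lt_self hε₀), ?_, ?_⟩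
  · rintro ε ⟨hε1, hε2⟩
    rcases hε1.eq_or_lt with rfl | hε1
    · exact uniq inj0
    · refine uniq fun y h1 h2 => ?_
      have := hδC ⟨hε1, hε2.trans_le (min_le_left _ _)⟩ y
      rw [h1, h2] at this
      simpa using this
  · intro f c y hy hf hc
    have hmem : ∀ᶠ ε in 𝓝[>] (0 : ℝ), ε ∈ Ioo 0 (min δ (ε₀ / 2)) :=
      Ioo_mem_nhdsGT (lt_min hδ0 (half_pos hε₀))
    obtain ⟨hy1, hy2⟩ := (isBVPSolution_iff hα).1
      (hy 0 ⟨le_rfl, lt_min hδ0 (half_pos hε₀)⟩)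
    have hLy : Tendsto (fun ε => odeCLM hα (A ε) (y 0)) (𝓝[>] 0) (𝓝 (f 0)) := by
      rw [← hy1]
      exact ((ContinuousLinearMap.apply ℂ _ (y 0)).continuous.tendsto _).comp (tendsto_odeCLM hα hA)
    have hBy : Tendsto (fun ε => B ε (y 0)) (𝓝[>] 0) (𝓝 (c 0)) := hy2 ▸ hB (y 0)
    rw [tendsto_iff_norm_sub_tendsto_zero]
    have hlim : Tendsto (fun ε => C * (‖f ε - odeCLM hα (A ε) (y 0)‖ + ‖c ε - B ε (y 0)‖))
        (𝓝[>] 0) (𝓝 0) := by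
      simpa using ((hf.sub hLy).norm.add (hc.sub hBy).norm).const_mul C
    refine squeeze_zero' (Eventually.of_forall fun _ => norm_nonneg _) ?_ hlim
    filter_upwards [hC, hmem] with ε h1 h2
    obtain ⟨e1, e2⟩ := (isBVPSolution_iff hα).1 (hy ε ⟨h2.1.le, h2.2⟩)
    have := h1 (y ε - y 0)
    rwa [map_sub, map_sub, e1, e2] at this

theorem DependsContinuouslyAtZero.tendsto (hα : α ≤ 1) (H : DependsContinuouslyAtZero ε₀ A B) :
    (∀ y : Fin m → HolderSpace h (n + r) α, IsBVPSolution (A 0) (B 0) 0 0 y → y = 0) ∧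
      (∀ l : Fin r, Tendsto (fun ε => A ε l) (𝓝[>] 0) (𝓝 (A 0 l))) ∧
      (∀ y : Fin m → HolderSpace h (n + r) α,
        Tendsto (fun ε => B ε y) (𝓝[>] 0) (𝓝 (B 0 y))) := by
  obtain ⟨ε₁, hε₁, -, hex, hconv⟩ := H
  have h0mem : (0 : ℝ) ∈ Ico 0 ε₁ := ⟨le_rfl, hε₁⟩
  have hbij : ∀ ε ∈ Ico 0 ε₁, Function.Bijective ((odeCLM hα (A ε)).prod (B ε)) := by
    intro ε hε
    constructor
    · intro y z hyz
      obtain ⟨w, -, hw⟩ := hex ε hε (odeCLM hα (A ε) z) (B ε z)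
      exact (hw y ((isBVPSolution_iff hα).2
        ⟨congrArg Prod.fst hyz, congrArg Prod.snd hyz⟩)).trans
        (hw z ((isBVPSolution_iff hα).2 ⟨rfl, rfl⟩)).symm
    · rintro ⟨f, c⟩
      obtain ⟨y, hy, -⟩ := hex ε hε f c
      obtain ⟨h1, h2⟩ := (isBVPSolution_iff hα).1 hy
      exact ⟨y, Prod.ext h1 h2⟩
  have hinv : ∀ ε, ∃ R : (Fin m → HolderSpace h n α) × EuclideanSpace ℂ (Fin (r * m)) →ₗ[ℂ]
      (Fin m → HolderSpace h (n + r) α), ε ∈ Ico 0 ε₁ →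
        (∀ y, R (odeCLM hα (A ε) y, B ε y) = y) ∧
        ∀ p, odeCLM hα (A ε) (R p) = p.1 ∧ B ε (R p) = p.2 := by
    intro ε
    by_cases hε : ε ∈ Ico 0 ε₁
    · let S := LinearEquiv.ofBijective ((odeCLM hα (A ε)).prod (B ε)).toLinearMap (hbij ε hε)
      refine ⟨S.symm.toLinearMap, fun _ => ⟨S.symm_apply_apply, fun p => ?_⟩⟩
      exact ⟨congrArg Prod.fst (S.apply_symm_apply p), congrArg Prod.snd (S.apply_symm_apply p)⟩
    · exact ⟨0, fun hε' => absurd hε' hε⟩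
  choose R hR using hinv
  have hmem : ∀ᶠ ε in 𝓝[>] (0 : ℝ), ε ∈ Ico 0 ε₁ := by
    filter_upwards [Ioo_mem_nhdsGT hε₁] with ε hε
    exact ⟨hε.1.le, hε.2⟩
  -- This is condition `(∗∗)` for the solutions `R(ε) p(ε)`.
  have hcont : ∀ p : ℝ → (Fin m → HolderSpace h n α) × EuclideanSpace ℂ (Fin (r * m)),
      Tendsto p (𝓝[>] 0) (𝓝 (p 0)) →
      Tendsto (fun ε => R ε (p ε)) (𝓝[>] 0) (𝓝 (R 0 (p 0))) := fun p hp =>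
    hconv (fun ε => (p ε).1) (fun ε => (p ε).2) (fun ε => R ε (p ε))
      (fun ε hε => (isBVPSolution_iff hα).2 ((hR ε hε).2 _))
      ((continuous_fst.tendsto _).comp hp) ((continuous_snd.tendsto _).comp hp)
  obtain ⟨C₁, hC₁, H₁⟩ := exists_coeffNorm_sub_le (h := h) (m := m) (r := r) (n := n) hα
  obtain ⟨C₂, -, H₂⟩ := exists_norm_odeCLM_sub_le (h := h) (m := m) (r := r) (n := n) hα
  have hA : ∀ l : Fin r, Tendsto (fun ε => A ε l) (𝓝[>] 0) (𝓝 (A 0 l)) :=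
    tendsto_coeffNorm_iff.1 <| tendsto_zero_of_continuous_inverse
      (L := fun ε => odeCLM hα (A ε)) (hR 0 h0mem).1
      (hmem.mono fun ε hε p => ((hR ε hε).2 p).1) hcont (monomialVec hα)
      (fun ε => by unfold coeffNorm; positivity) hC₁ (fun ε => H₁ _ _) (fun ε => H₂ _ _)
  refine ⟨fun y hy => ?_, hA, ?_⟩
  · obtain ⟨h1, h2⟩ := (isBVPSolution_iff hα).1 hy
    refine (hbij 0 h0mem).1 (Prod.ext ?_ ?_)
    · exact h1.trans (map_zero _).symm
    · exact h2.trans (map_zero _).symm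
  · exact tendsto_apply_of_continuous_inverse (L := fun ε => odeCLM hα (A ε)) (hR 0 h0mem).1
      (fun p => ((hR 0 h0mem).2 p).2) (hmem.mono fun ε hε => (hR ε hε).1)
      (hmem.mono fun ε hε p => ((hR ε hε).2 p).2) hcont (tendsto_odeCLM hα hA)

end Main

theorem mainTheorem1 {a b : ℝ} (h : a < b) (m r n : ℕ) (hm : 1 ≤ m) (hr : 2 ≤ r)
    (α : ℝ) (hα₀ : 0 < α) (hα₁ : α ≤ 1) (ε₀ : ℝ) (hε₀ : 0 < ε₀)
    (A : ℝ → Fin r → Matrix (Fin m) (Fin m) (HolderSpace h n α))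
    (B : ℝ → (Fin m → HolderSpace h (n + r) α) →L[ℂ] EuclideanSpace ℂ (Fin (r * m))) :
    DependsContinuouslyAtZero ε₀ A B ↔
      (∀ y : Fin m → HolderSpace h (n + r) α, IsBVPSolution (A 0) (B 0) 0 0 y → y = 0) ∧
      (∀ l : Fin r, Tendsto (fun ε => A ε l) (𝓝[>] 0) (𝓝 (A 0 l))) ∧
      (∀ y : Fin m → HolderSpace h (n + r) α,
        Tendsto (fun ε => B ε y) (𝓝[>] 0) (𝓝 (B 0 y))) :=
  ⟨fun H => H.tendsto hα₁, fun ⟨h0, hA, hB⟩ =>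
    dependsContinuouslyAtZero_of_tendsto hα₁ hε₀ h0 hA hB⟩
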